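/- Let $\mathbb{I}=[0,1]$ and $d\ge 2$. A $d$-dimensional copula is a function $C:\mathbb{I}^d\to\mathbb{I}$ with $C(\mathbf{x})=\mu_C([\mathbf{0},\mathbf{x}])$ for a probability measure $\mu_C$ on $\mathbb{I}^d$ whose one-dimensional marginals are uniform. It is Archimedean with generator $\psi$ if $\psi:[0,\infty)\to\mathbb{I}$ is continuous and non-increasing with $\psi(0)=1$ and $\lim_{z\to\infty}\psi(z)=0=:\psi(\infty)$, is strictly decreasing on $[0,\varphi(0)]\cap[0,\infty)$, and $$C(\mathbf{x})=\psi\big(\varphi(x_1)+\dots+\varphi(x_d)\big)\quad\text{for all }\mathbf{x}\in\mathbb{I}^d,$$ where $\varphi(t)=\inf\{z\in[0,\infty]:\psi(z)=t\}$ for $t\in\mathbb{I}$. **Theorem.** Let $C$ be a $d$-dimensional Archimedean copula with generator $\psi$ and let $\ell\in\{1,\dots,d-1\}$. Then $\psi$ is $d-2$ times continuously differentiable on $(0,\infty)$, and $\psi^{(d-2)}$ has a (finite) left-hand derivative $D^-\psi^{(d-2)}$ everywhere on $(0,\infty)$. For $\ell\le d-2$ let $\psi^{(\ell)}$ be the $\ell$-th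 derivative of $\psi$ on $(0,\infty)$, and for $\ell=d-1$ let $\psi^{(\ell)}:=D^-\psi^{(d-2)}$; in both cases put $\psi^{(\ell)}(\infty):=0$. Let $L_0=\{(\mathbf{x},\mathbf{y})\in\mathbb{I}^\ell\times\mathbb{I}^{d-\ell}:C(\mathbf{x},\mathbf{y})=0\}$, let $\operatorname{int}L_0$ be its interior relative to $\mathbb{I}^d$, and let $L_0^{1:\ell}=\{\mathbf{x}\in\mathbb{I}^\ell:C(\mathbf{x},1,\dots,1)=0\}$. Then there is a Markov kernel $K_\psi$ from $\mathbb{I}^\ell$ to $\mathbb{I}^{d-\ell}$ such that, for all $\mathbf{x}\in\mathbb{I}^\ell$ and $\mathbf{y}\in\mathbb{I}^{d-\ell}$, $$K_\psi(\mathbf{x},[\mathbf{0},\mathbf{y}])=\begin{cases}1&\text{if }\min(\mathbf{x})=1\text{ or }\mathbf{x}\in L_0^{1:\ell},\\[2pt] 0&\text{if }\min(\mathbf{x})\in(0,1),\ \mathbf{x}\notin L_0^{1:\ell},\ (\mathbf{x},\mathbf{y})\in\operatorname{int}L_0,\\[2pt] \dfrac{\psi^{(\ell)}\big(\sum_{i=1}^{\ell}\varphi(x_i)+\sum_{j=1}^{d-\ell}\varphi(y_j)\big)}{\psi^{(\ell)}\big(\sum_{i=1}^{\ell}\varphi(x_i)\big)}&\text{if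 }\min(\mathbf{x})\in(0,1),\ \mathbf{x}\notin L_0^{1:\ell},\ (\mathbf{x},\mathbf{y})\notin\operatorname{int}L_0,\end{cases}$$ and $K_\psi$ is a version of the $\ell$-Markov kernel of $C$: if $\mathbf{X}$ and $\mathbf{Y}$ are the first $\ell$ and the last $d-\ell$ coordinates on the probability space $(\mathbb{I}^d,\mu_C)$, then for every Borel set $E\subseteq\mathbb{I}^{d-\ell}$ one has $K_\psi(\mathbf{X},E)=\mathbb{E}(\mathbf{1}_E\circ\mathbf{Y}\mid\mathbf{X})$ $\mu_C$-almost surely. -/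

import Mathlib

open Set Filter Topology MeasureTheory ProbabilityTheory
open scoped unitInterval ENNReal

noncomputable section

namespace ArchCopula

/-- `μ` is the `d`-stochastic measure of `C`: a probability measure on the cube `[0,1]^d` all of
whose one-dimensional marginals are uniform on `[0,1]`, and `μ([0,x]) = C(x)` for every `x`.
(In `Fin d → I` the box `[0,x]` is `Set.Iic x`.) -/
structure IsStochasticMeasure {d : ℕ} (C : (Fin d → I) → ℝ) (μ : Measure (Fin d → I)) : Prop where
  isProbabilityMeasure : IsProbabilityMeasure μ
  marginal : ∀ i : Fin d, μ.map (fun u => u i) = (volume : Measure I)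
  cdf : ∀ x : Fin d → I, μ.real (Iic x) = C x

/-- A `d`-dimensional copula: the distribution function, on `[0,1]^d`, of a probability measure
with uniform marginals. -/
def IsCopula {d : ℕ} (C : (Fin d → I) → ℝ) : Prop :=
  ∃ μ : Measure (Fin d → I), IsStochasticMeasure C μ

/-- A function on `[0,∞)` extended to `[0,∞]` by the value `0` at `∞`. -/
def extendTop (f : ℝ → ℝ) (z : ℝ≥0∞) : ℝ :=
  if z = ∞ then 0 else f z.toReal

/-- The pseudoinverse `φ : [0,1] → [0,∞]` of `ψ`, `φ(t) = inf {z ∈ [0,∞] : ψ(z) = t}`, where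
`ψ(∞) = 0`. On `(0,1]` this is the inverse function of a generator `ψ`. -/
def pseudoInv (ψ : ℝ → ℝ) (t : I) : ℝ≥0∞ :=
  sInf {z : ℝ≥0∞ | extendTop ψ z = (t : ℝ)}

/-- An Archimedean generator; only the values of `ψ` on `[0,∞)` matter. -/
structure IsGenerator (ψ : ℝ → ℝ) : Prop where
  mapsTo : MapsTo ψ (Ici 0) (Icc 0 1)
  continuousOn : ContinuousOn ψ (Ici 0)
  antitoneOn : AntitoneOn ψ (Ici 0)
  map_zero : ψ 0 = 1
  tendsto_zero : Tendsto ψ atTop (𝓝 0)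
  strictAntiOn : StrictAntiOn ψ {z : ℝ | 0 ≤ z ∧ ENNReal.ofReal z ≤ pseudoInv ψ 0}

/-- `C` is an Archimedean copula with generator `ψ`:
`C` is a copula and `C(x) = ψ(φ(x₁) + ⋯ + φ(x_d))`. -/
structure IsArchimedeanCopula {d : ℕ} (ψ : ℝ → ℝ) (C : (Fin d → I) → ℝ) : Prop where
  isCopula : IsCopula C
  isGenerator : IsGenerator ψ
  eq : ∀ x : Fin d → I, C x = extendTop ψ (∑ i, pseudoInv ψ (x i))

/-- The marginal of the first `ℓ` coordinates, `x ↦ C(x, 1, …, 1)`. -/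
def firstMarginal {ℓ m : ℕ} (C : (Fin (ℓ + m) → I) → ℝ) (x : Fin ℓ → I) : ℝ :=
  C (Fin.append x (fun _ : Fin m => 1))

/-- The zero set of a function on the cube. Its interior is taken relative to the cube. -/
def zeroSet {d : ℕ} (C : (Fin d → I) → ℝ) : Set (Fin d → I) :=
  {u | C u = 0}

/-- The left-hand derivative `D⁻f(z)`. -/
def leftDeriv (f : ℝ → ℝ) (z : ℝ) : ℝ :=
  derivWithin f (Iic z) z

/-- The derivative `ψ^(ℓ)` on `(0,∞]`, with value `0` at `∞`; for `ℓ = d - 1` it is understood as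
the left-hand derivative `D⁻ψ^(d-2)`. -/
def genDeriv (d ℓ : ℕ) (ψ : ℝ → ℝ) : ℝ≥0∞ → ℝ :=
  extendTop (if ℓ + 1 = d then leftDeriv (iteratedDeriv (d - 2) ψ) else iteratedDeriv ℓ ψ)

open Classical in
/-- The explicit expression for `K(x, [0,y])`, with `x ∈ [0,1]^ℓ`, `y ∈ [0,1]^m` and `d = ℓ + m`.
For `ℓ ≥ 1` the condition `∀ i, x i = 1` says `min x = 1`; if `min x = 0` then
`x` lies in the zero set of the marginal, so `min x ∈ (0,1)` in the last two cases. -/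
def kernelCDF {ℓ m : ℕ} (ψ : ℝ → ℝ) (C : (Fin (ℓ + m) → I) → ℝ)
    (x : Fin ℓ → I) (y : Fin m → I) : ℝ :=
  if (∀ i, x i = 1) ∨ x ∈ zeroSet (firstMarginal C) then 1
  else if Fin.append x y ∈ interior (zeroSet C) then 0
  else genDeriv (ℓ + m) ℓ ψ (∑ i, pseudoInv ψ (x i) + ∑ j, pseudoInv ψ (y j)) /
    genDeriv (ℓ + m) ℓ ψ (∑ i, pseudoInv ψ (x i))

/-- The Markov kernel `K` is a regular conditional distribution of `Y` given `X` under `P`: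
for every measurable `E`, `K(X, E) = 𝔼(1_E ∘ Y | X)` almost surely. -/
def IsRegularCondDistrib {Ω α β : Type*} [MeasurableSpace Ω] [MeasurableSpace α]
    [MeasurableSpace β] (K : Kernel α β) (Y : Ω → β) (X : Ω → α) (P : Measure Ω) : Prop :=
  IsMarkovKernel K ∧ ∀ E : Set β, MeasurableSet E →
    (fun ω => (K (X ω)).real E) =ᵐ[P]
      P[fun ω => E.indicator (fun _ => (1 : ℝ)) (Y ω) | MeasurableSpace.comap X inferInstance]

/-- `K` is (a version of) the `ℓ`-Markov kernel of the copula with measure `μ`: a regular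
conditional distribution of the last `m` coordinates given the first `ℓ` coordinates. -/
def IsMarkovKernelOf {ℓ m : ℕ} (K : Kernel (Fin ℓ → I) (Fin m → I))
    (μ : Measure (Fin (ℓ + m) → I)) : Prop :=
  IsRegularCondDistrib K (fun u (j : Fin m) => u (Fin.natAdd ℓ j))
    (fun u (i : Fin ℓ) => u (Fin.castAdd m i)) μ

end ArchCopula

end

/-! In the coordinates `x_i = ψ(s_i)` the copula measure gives the box `[0, x]` the mass `ψ(s_1 + ⋯
+ s_d)`, so `ψ` is a survival function depending only on the ℓ¹-norm (`Surv`). One operation drives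
the proof. Restricting such a measure to a slab in its first coordinate and forgetting that
coordinate replaces `F` by the increment `F(c + ·) - F(c' + ·)` and lowers the dimension by one
(`Surv.diff`).

Survival functions in dimension at least 1 are nonnegative and antitone. Hence in dimension at least
2 the increments of `F` are antitone, and a continuous `F` is convex; in dimension at least 3 the
increments are convex as well, and `F` is differentiable. Dividing increments by their length and
passing to a weak limit of measures (`Surv.of_tendsto`) shows that `-D⁻F`, shifted by any `z > 0`,
is a survival function in one dimension less. Iteration (`Surv.altDeriv_regular`,
`Surv.surv_altDeriv`) gives the regularity of `ψ` and, at order `ℓ`, measures on the last `d - ℓ`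
coordinates with box masses `(-1)^ℓ ψ^(ℓ)(z + ∑ t_j)`. With `z = ∑ φ(x_i)` and after normalization,
these are the measures `K(x, ·)`.

That `K` is the conditional law is a density computation. Integrating `(-1)^ℓ ψ^(ℓ)(∑ s_i)` over an
`ℓ`-dimensional orthant undoes the `ℓ` derivatives, so this is the density of the first `ℓ`
coordinates in the variable `s`. Multiplying by the kernel cancels the denominator, and the same
integration returns `ψ(∑ s_i + ∑ t_j)`, the mass of the joint box. Boxes form a generating π-system,
so the joint law is the composition product (`IsArchimedeanCopula.map_prod_eq_compProd`), and
uniqueness of conditional distributions concludes.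

The delicate case is a generator with a first zero `b`. The left derivative of order `d - 1` may be
nonzero at `b` itself and is sure to vanish only beyond it. Hence the role of the interior of the
zero set, and the cut of the density on a null set in `cutDeriv`. -/

namespace ArchCopula

/-! ### Generators and their pseudoinverses -/

/-- The value `ψ(s)` of a generator as a point of the unit interval, constant for `s ≤ 0`. -/
noncomputable def pt (ψ : ℝ → ℝ) (s : ℝ) : I := Set.projIcc 0 1 zero_le_one (ψ (max s 0))

section Generator

variable {ψ : ℝ → ℝ}

lemma IsGenerator.nonneg (h : IsGenerator ψ) {s : ℝ} (hs : 0 ≤ s) : 0 ≤ ψ s := (h.mapsTo hs).1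

lemma IsGenerator.coe_pt (h : IsGenerator ψ) {s : ℝ} (hs : 0 ≤ s) : (pt ψ s : ℝ) = ψ s := by
  rw [pt, max_eq_left hs, projIcc_of_mem _ (h.mapsTo hs)]

lemma IsGenerator.antitone_pt (h : IsGenerator ψ) : Antitone (pt ψ) := fun _ _ hab =>
  monotone_projIcc _ (h.antitoneOn (mem_Ici.2 (le_max_right _ _)) (mem_Ici.2 (le_max_right _ _))
    (max_le_max_right 0 hab))

lemma IsGenerator.continuous_pt (h : IsGenerator ψ) : Continuous (pt ψ) :=
  continuous_projIcc.comp
    (h.continuousOn.comp_continuous (by fun_prop) fun _ => mem_Ici.2 (le_max_right _ _))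

lemma IsGenerator.pt_zero (h : IsGenerator ψ) : pt ψ 0 = 1 :=
  Subtype.ext (by rw [h.coe_pt le_rfl, h.map_zero]; rfl)

lemma IsGenerator.antitone_extendTop (h : IsGenerator ψ) : Antitone (extendTop ψ) := by
  intro z w hzw
  unfold extendTop
  by_cases hw : w = ∞
  · rw [if_pos hw]
    split_ifs
    · rfl
    · exact h.nonneg ENNReal.toReal_nonneg
  · have hz : z ≠ ∞ := ne_top_of_le_ne_top hw hzw
    rw [if_neg hw, if_neg hz]
    exact h.antitoneOn ENNReal.toReal_nonneg ENNReal.toReal_nonneg (ENNReal.toReal_mono hw hzw)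

lemma extendTop_ofReal (f : ℝ → ℝ) {s : ℝ} (hs : 0 ≤ s) : extendTop f (ENNReal.ofReal s) = f s := by
  rw [extendTop, if_neg ENNReal.ofReal_ne_top, ENNReal.toReal_ofReal hs]

lemma extendTop_top (f : ℝ → ℝ) : extendTop f ∞ = 0 := if_pos rfl

lemma IsGenerator.extendTop_nonneg (h : IsGenerator ψ) (z : ℝ≥0∞) : 0 ≤ extendTop ψ z := by
  rw [← extendTop_top ψ]; exact h.antitone_extendTop le_top

/-- If `ψ t > 0`, then `t` lies at or below `φ(0)`, within the range where strict decrease is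
assumed; if `ψ t = 0`, positivity of `ψ s` suffices. -/
lemma IsGenerator.lt_of_lt (h : IsGenerator ψ) {s t : ℝ} (hs : 0 ≤ s) (hst : s < t)
    (hpos : 0 < ψ s) : ψ t < ψ s := by
  have ht : 0 ≤ t := hs.trans hst.le
  rcases (h.nonneg ht).eq_or_lt with h0 | h0
  · rwa [← h0]
  have key : ENNReal.ofReal t ≤ pseudoInv ψ 0 := by
    refine le_sInf fun z hz => ?_
    by_contra! hlt
    have := h.antitone_extendTop hlt.le
    rw [extendTop_ofReal ψ ht, show extendTop ψ z = 0 from hz] at this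
    linarith
  exact h.strictAntiOn ⟨hs, (ENNReal.ofReal_le_ofReal hst.le).trans key⟩ ⟨ht, key⟩ hst

lemma IsGenerator.pseudoInv_eq (h : IsGenerator ψ) {s : ℝ} (hs : 0 ≤ s) (hpos : 0 < ψ s) {u : I}
    (hu : (u : ℝ) = ψ s) : pseudoInv ψ u = ENNReal.ofReal s := by
  refine le_antisymm (sInf_le ?_) (le_sInf fun z hz => ?_)
  · rw [mem_ofPred_eq, extendTop_ofReal ψ hs, hu]
  · by_contra! hlt
    have hz' : z ≠ ∞ := hlt.ne_top
    rw [mem_ofPred_eq, hu, ← ENNReal.ofReal_toReal hz',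
      extendTop_ofReal ψ ENNReal.toReal_nonneg] at hz
    have h1 : z.toReal < s := by
      rw [← ENNReal.ofReal_toReal hz'] at hlt
      exact (ENNReal.ofReal_lt_ofReal_iff_of_nonneg ENNReal.toReal_nonneg).1 hlt
    have := h.lt_of_lt ENNReal.toReal_nonneg h1 (hz ▸ hpos)
    linarith

lemma IsGenerator.pseudoInv_pt (h : IsGenerator ψ) {s : ℝ} (hs : 0 ≤ s) (hpos : 0 < ψ s) :
    pseudoInv ψ (pt ψ s) = ENNReal.ofReal s :=
  h.pseudoInv_eq hs hpos (h.coe_pt hs)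

lemma IsGenerator.exists_pt_eq_of_pos (h : IsGenerator ψ) {u : I} (hu : 0 < (u : ℝ)) :
    ∃ s, 0 ≤ s ∧ pt ψ s = u := by
  obtain ⟨R, hR, hRu⟩ := (((h.tendsto_zero.eventually_lt_const hu)).and
    (eventually_ge_atTop 0)).exists
  have := intermediate_value_Icc' hRu (h.continuousOn.mono Icc_subset_Ici_self)
  obtain ⟨s, hs, hsu⟩ := this ⟨hR.le, by rw [h.map_zero]; exact u.2.2⟩
  exact ⟨s, hs.1, Subtype.ext (by rw [h.coe_pt hs.1, hsu])⟩

/-- A zero of a generator can be replaced by the first one. -/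
lemma IsGenerator.exists_first_zero (h : IsGenerator ψ) {s : ℝ} (hs : 0 ≤ s) (h0 : ψ s = 0) :
    ∃ b, 0 < b ∧ b ≤ s ∧ ψ b = 0 ∧ ∀ r, 0 ≤ r → r < b → 0 < ψ r := by
  have hcl : IsClosed (Icc 0 s ∩ ψ ⁻¹' {0}) :=
    (h.continuousOn.mono Icc_subset_Ici_self).preimage_isClosed_of_isClosed isClosed_Icc
      isClosed_singleton
  have hcomp : IsCompact (Icc 0 s ∩ ψ ⁻¹' {0}) :=
    isCompact_Icc.of_isClosed_subset hcl inter_subset_left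
  obtain ⟨b, ⟨hb, hb0⟩, hmin⟩ := hcomp.exists_isLeast ⟨s, ⟨hs, le_rfl⟩, h0⟩
  refine ⟨b, hb.1.lt_of_ne ?_, hb.2, hb0, fun r hr hrb => (h.nonneg hr).lt_of_ne' fun hr0 => ?_⟩
  · rintro rfl
    simp [h.map_zero] at hb0
  · exact absurd (hmin ⟨⟨hr, hrb.le.trans hb.2⟩, hr0⟩) hrb.not_ge

lemma pseudoInv_zero_of_zero {b : ℝ} (hb : 0 ≤ b) (hb0 : ψ b = 0)
    (hlt : ∀ r, 0 ≤ r → r < b → 0 < ψ r) : pseudoInv ψ 0 = ENNReal.ofReal b := by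
  refine le_antisymm (sInf_le ?_) (le_sInf fun z hz => ?_)
  · rw [mem_ofPred_eq, extendTop_ofReal ψ hb, hb0]; rfl
  · by_contra! hl
    have hz' : z ≠ ∞ := hl.ne_top
    rw [mem_ofPred_eq, ← ENNReal.ofReal_toReal hz',
      extendTop_ofReal ψ ENNReal.toReal_nonneg] at hz
    have h1 : z.toReal < b := by
      rw [← ENNReal.ofReal_toReal hz'] at hl
      exact (ENNReal.ofReal_lt_ofReal_iff_of_nonneg ENNReal.toReal_nonneg).1 hl
    have := hlt _ ENNReal.toReal_nonneg h1
    rw [hz] at this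
    exact lt_irrefl _ this

lemma IsGenerator.exists_of_pseudoInv_ne_top (h : IsGenerator ψ) {u : I}
    (hu : pseudoInv ψ u ≠ ∞) : ∃ s, 0 ≤ s ∧ pt ψ s = u ∧ pseudoInv ψ u = ENNReal.ofReal s := by
  rcases u.2.1.eq_or_lt with h0 | h0
  · have hu0 : u = 0 := Subtype.ext h0.symm
    subst hu0
    obtain ⟨z, hz, hz'⟩ := sInf_lt_iff.1 (lt_top_iff_ne_top.2 hu)
    rw [mem_ofPred_eq, ← ENNReal.ofReal_toReal hz'.ne,
      extendTop_ofReal ψ ENNReal.toReal_nonneg] at hz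
    obtain ⟨b, hb, -, hb0, hlt⟩ := h.exists_first_zero ENNReal.toReal_nonneg hz
    exact ⟨b, hb.le, Subtype.ext (by rw [h.coe_pt hb.le, hb0]; rfl),
      pseudoInv_zero_of_zero hb.le hb0 hlt⟩
  · obtain ⟨s, hs, rfl⟩ := h.exists_pt_eq_of_pos h0
    exact ⟨s, hs, rfl, h.pseudoInv_pt hs (by rwa [h.coe_pt hs] at h0)⟩

lemma IsGenerator.pseudoInv_ne_top_of_pos (h : IsGenerator ψ) {u : I} (hu : 0 < (u : ℝ)) :
    pseudoInv ψ u ≠ ∞ := by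
  obtain ⟨s, hs, rfl⟩ := h.exists_pt_eq_of_pos hu
  rw [h.pseudoInv_pt hs (by rwa [h.coe_pt hs] at hu)]
  exact ENNReal.ofReal_ne_top

lemma IsGenerator.extendTop_pseudoInv (h : IsGenerator ψ) (u : I) :
    extendTop ψ (pseudoInv ψ u) = u := by
  by_cases hu : pseudoInv ψ u = ∞
  · rw [hu, extendTop_top]
    by_contra hne
    exact h.pseudoInv_ne_top_of_pos (lt_of_le_of_ne u.2.1 hne) hu
  · obtain ⟨s, hs, hsu, hs'⟩ := h.exists_of_pseudoInv_ne_top hu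
    rw [hs', extendTop_ofReal ψ hs, ← hsu, h.coe_pt hs]

lemma IsGenerator.antitone_pseudoInv (h : IsGenerator ψ) : Antitone (pseudoInv ψ) := by
  intro u v huv
  by_contra! hlt
  have h1 := h.antitone_extendTop hlt.le
  rw [h.extendTop_pseudoInv, h.extendTop_pseudoInv] at h1
  have : u = v := le_antisymm huv h1
  exact hlt.ne (by rw [this])

lemma IsGenerator.measurable_pseudoInv (h : IsGenerator ψ) : Measurable (pseudoInv ψ) :=
  h.antitone_pseudoInv.measurable

lemma IsGenerator.pseudoInv_eq_zero_iff (h : IsGenerator ψ) {u : I} :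
    pseudoInv ψ u = 0 ↔ u = 1 := by
  constructor
  · intro hu
    have := h.extendTop_pseudoInv u
    rw [hu, extendTop, if_neg ENNReal.zero_ne_top, ENNReal.toReal_zero, h.map_zero] at this
    exact Subtype.ext this.symm
  · rintro rfl
    rw [h.pseudoInv_eq le_rfl (by rw [h.map_zero]; exact one_pos) (by rw [h.map_zero]; rfl),
      ENNReal.ofReal_zero]

lemma sum_ofReal {n : ℕ} {s : Fin n → ℝ} (hs : ∀ i, 0 ≤ s i) :
    ∑ i, ENNReal.ofReal (s i) = ENNReal.ofReal (∑ i, s i) :=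
  (ENNReal.ofReal_sum_of_nonneg fun i _ => hs i).symm

/-- The identity `φ(ψ(s)) = s` can fail where `ψ` vanishes, but one such coordinate already makes
both sides zero. -/
lemma IsGenerator.extendTop_sum_pseudoInv_pt (h : IsGenerator ψ) {n : ℕ} {s : Fin n → ℝ}
    (hs : ∀ i, 0 ≤ s i) : extendTop ψ (∑ i, pseudoInv ψ (pt ψ (s i))) = ψ (∑ i, s i) := by
  have hsum : 0 ≤ ∑ i, s i := Finset.sum_nonneg fun i _ => hs i
  by_cases hpos : ∀ i, 0 < ψ (s i)
  · rw [Finset.sum_congr rfl fun i _ => h.pseudoInv_pt (hs i) (hpos i), sum_ofReal hs,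
      extendTop_ofReal ψ hsum]
  · push Not at hpos
    obtain ⟨i, hi⟩ := hpos
    have hle : s i ≤ ∑ i, s i := Finset.single_le_sum (fun j _ => hs j) (Finset.mem_univ i)
    have h1 : ψ (∑ i, s i) = 0 :=
      le_antisymm ((h.antitoneOn (hs i) hsum hle).trans hi) (h.nonneg hsum)
    have h2 : pseudoInv ψ (pt ψ (s i)) ≤ ∑ i, pseudoInv ψ (pt ψ (s i)) :=
      Finset.single_le_sum (f := fun i => pseudoInv ψ (pt ψ (s i))) (fun j _ => zero_le)
        (Finset.mem_univ i)
    have h3 := h.antitone_extendTop h2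
    rw [h.extendTop_pseudoInv, h.coe_pt (hs i)] at h3
    rw [h1]
    exact le_antisymm (h3.trans hi) (h.extendTop_nonneg _)

lemma IsGenerator.pt_le_iff (h : IsGenerator ψ) {s : ℝ} (hs : 0 ≤ s) {t : ℝ} (ht : 0 ≤ t)
    (hpos : 0 < ψ t) : pt ψ s ≤ pt ψ t ↔ t ≤ s := by
  refine ⟨fun hle => ?_, fun hle => h.antitone_pt hle⟩
  by_contra! hlt
  have h1 : ψ s ≤ ψ t := by rw [← h.coe_pt hs, ← h.coe_pt ht]; exact hle
  have := h.lt_of_lt hs hlt (hpos.trans_le (h.antitoneOn hs ht hlt.le))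
  linarith

end Generator

/-! ### Measures on the cube with an `ℓ¹`-norm symmetric survival function -/

/-- There is a finite measure on `[0,1]^m` which, in the coordinates given by `ψ`, has the survival
function `s ↦ F (s₁ + ⋯ + s_m)`. -/
def Surv (ψ : ℝ → ℝ) (m : ℕ) (F : ℝ → ℝ) : Prop :=
  ∃ ν : Measure (Fin m → I), IsFiniteMeasure ν ∧
    ∀ s : Fin m → ℝ, (∀ i, 0 ≤ s i) → ν.real (Iic fun i => pt ψ (s i)) = F (∑ i, s i)

section Surv

variable {ψ : ℝ → ℝ} {m : ℕ} {F : ℝ → ℝ}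

lemma IsArchimedeanCopula.surv {d : ℕ} {C : (Fin d → I) → ℝ} (hC : IsArchimedeanCopula ψ C) :
    Surv ψ d ψ := by
  obtain ⟨μ, hμ⟩ := hC.isCopula
  have := hμ.isProbabilityMeasure
  exact ⟨μ, inferInstance, fun s hs => by
    rw [hμ.cdf, hC.eq, hC.isGenerator.extendTop_sum_pseudoInv_pt hs]⟩

lemma mem_Iic_pt_cons {u : Fin (m + 1) → I} {c : ℝ} {s : Fin m → ℝ} :
    (u ∈ Iic fun i => pt ψ ((Fin.cons c s : Fin (m + 1) → ℝ) i)) ↔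
      u 0 ≤ pt ψ c ∧ Fin.tail u ∈ Iic fun i => pt ψ (s i) := by
  simp only [mem_Iic, Pi.le_def, Fin.forall_fin_succ, Fin.cons_zero, Fin.cons_succ, Fin.tail]

lemma measurable_tail : Measurable (Fin.tail : (Fin (m + 1) → I) → Fin m → I) :=
  measurable_pi_lambda _ fun i => measurable_pi_apply i.succ

lemma cons_nonneg {c : ℝ} (hc : 0 ≤ c) {s : Fin m → ℝ} (hs : ∀ i, 0 ≤ s i) (i : Fin (m + 1)) :
    0 ≤ (Fin.cons c s : Fin (m + 1) → ℝ) i := by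
  refine Fin.cases ?_ (fun j => ?_) i
  · simpa using hc
  · simpa using hs j

lemma Surv.congr {G : ℝ → ℝ} (hF : Surv ψ m F) (hFG : ∀ r, 0 ≤ r → F r = G r) : Surv ψ m G := by
  obtain ⟨ν, hν, h⟩ := hF
  exact ⟨ν, hν, fun s hs => by rw [h s hs, hFG _ (Finset.sum_nonneg fun i _ => hs i)]⟩

/-- The measure is restricted to the slab `ψ(c') < u₀ ≤ ψ(c)` and projected to the remaining
coordinates; a box in the slab is the difference of two boxes. -/
lemma Surv.diff (h : IsGenerator ψ) (hF : Surv ψ (m + 1) F) {c c' : ℝ} (hc : 0 ≤ c)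
    (hcc : c ≤ c') : Surv ψ m fun r => F (c + r) - F (c' + r) := by
  obtain ⟨ν, hν, hs'⟩ := hF
  refine ⟨(ν.restrict {u | u 0 ∈ Ioc (pt ψ c') (pt ψ c)}).map Fin.tail, inferInstance,
    fun s hs => ?_⟩
  rw [map_measureReal_apply measurable_tail measurableSet_Iic,
    measureReal_restrict_apply (measurable_tail measurableSet_Iic)]
  have h1 := hs' (Fin.cons c s) (cons_nonneg hc hs)
  have h2 := hs' (Fin.cons c' s) (cons_nonneg (hc.trans hcc) hs)
  rw [Fin.sum_cons] at h1 h2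
  beta_reduce
  rw [← h1, ← h2, ← measureReal_sdiff _ measurableSet_Iic]
  · congr 1
    ext u
    rw [Set.mem_sdiff, mem_Iic_pt_cons, mem_Iic_pt_cons]
    simp only [mem_inter_iff, mem_preimage, mem_ofPred_eq, mem_Ioc, ← not_le]
    tauto
  · intro u
    rw [mem_Iic_pt_cons, mem_Iic_pt_cons]
    exact fun hu => ⟨hu.1.trans (h.antitone_pt hcc), hu.2⟩

lemma Surv.const_mul (hF : Surv ψ m F) {a : ℝ} (ha : 0 ≤ a) : Surv ψ m fun r => a * F r := by
  obtain ⟨ν, hν, h⟩ := hF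
  refine ⟨ENNReal.ofReal a • ν, ν.smul_finite ENNReal.ofReal_ne_top, fun s hs => ?_⟩
  rw [measureReal_ennreal_smul_apply, ENNReal.toReal_ofReal ha, h s hs]

lemma Surv.nonneg (hF : Surv ψ (m + 1) F) {r : ℝ} (hr : 0 ≤ r) : 0 ≤ F r := by
  obtain ⟨ν, hν, h⟩ := hF
  have h1 := h (Fin.cons r fun _ => 0) (cons_nonneg hr fun _ => le_rfl)
  rw [Fin.sum_cons] at h1
  simp only [Finset.sum_const_zero, add_zero] at h1
  rw [← h1]
  exact measureReal_nonneg

lemma Surv.antitoneOn (h : IsGenerator ψ) (hF : Surv ψ (m + 1) F) : AntitoneOn F (Ici 0) := by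
  intro r hr r' hr' hrr
  obtain ⟨ν, hν, hs⟩ := hF
  have h1 := hs (Fin.cons r fun _ => 0) (cons_nonneg hr fun _ => le_rfl)
  have h2 := hs (Fin.cons r' fun _ => 0) (cons_nonneg hr' fun _ => le_rfl)
  rw [Fin.sum_cons] at h1 h2
  simp only [Finset.sum_const_zero, add_zero] at h1 h2
  rw [← h1, ← h2]
  refine measureReal_mono fun u => ?_
  rw [mem_Iic_pt_cons, mem_Iic_pt_cons]
  exact fun hu => ⟨hu.1.trans (h.antitone_pt hrr), hu.2⟩

/-- The interior is relative to the cube, so a coordinate with `s' i = 0`, where `ψ = 1`, imposes no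
constraint and needs no strict inequality. -/
lemma Iic_pt_subset_interior {s s' : Fin m → ℝ}
    (hss : ∀ i, s' i = 0 ∨ pt ψ (s i) < pt ψ (s' i)) (h : IsGenerator ψ) :
    (Iic fun i => pt ψ (s i)) ⊆ interior (Iic fun i => pt ψ (s' i)) := by
  have hopen : IsOpen (⋂ i, {u : Fin m → I | s' i = 0 ∨ u i < pt ψ (s' i)}) := by
    refine isOpen_iInter_of_finite fun i => ?_
    by_cases hi : s' i = 0
    · simp [hi]
    · simp only [hi, false_or]
      exact isOpen_lt (continuous_apply i) continuous_const
  refine Subset.trans (fun u hu => ?_) (interior_maximal (fun u hu i => ?_) hopen)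
  · exact mem_iInter.2 fun i => (hss i).imp_right fun hlt => (hu i).trans_lt hlt
  · rcases mem_iInter.1 hu i with hi | hi
    · change u i ≤ pt ψ (s' i)
      rw [hi, h.pt_zero]
      exact le_top
    · exact hi.le

/-- A pointwise limit of survival functions which is continuous from the left is a survival
function. -/
theorem Surv.of_tendsto (h : IsGenerator ψ) {L : Filter ℝ} [L.NeBot] {Fn : ℝ → ℝ → ℝ}
    (hS : ∀ᶠ t in L, Surv ψ m (Fn t))
    (hlim : ∀ r, 0 ≤ r → Tendsto (fun t => Fn t r) L (𝓝 (F r)))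
    (hcont : ∀ r, 0 < r → ContinuousWithinAt F (Iic r) r)
    (hz : ∀ s, 0 ≤ s → ψ s = 0 → ∃ r, 0 ≤ r ∧ 0 < ψ r ∧ F r = 0) : Surv ψ m F := by
  have hN : ∀ t, ∃ N : FiniteMeasure (Fin m → I), Surv ψ m (Fn t) →
      ∀ s : Fin m → ℝ, (∀ i, 0 ≤ s i) →
        (N : Measure (Fin m → I)).real (Iic fun i => pt ψ (s i)) = Fn t (∑ i, s i) := by
    intro t
    by_cases ht : Surv ψ m (Fn t)
    · obtain ⟨ν, hν, hs⟩ := ht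
      exact ⟨⟨ν, hν⟩, fun _ => hs⟩
    · exact ⟨0, fun h => absurd h ht⟩
  choose N hN using hN
  have hNs : ∀ s : Fin m → ℝ, (∀ i, 0 ≤ s i) → ∀ᶠ t in L,
      (N t : Measure (Fin m → I)).real (Iic fun i => pt ψ (s i)) = Fn t (∑ i, s i) := by
    intro s hs
    filter_upwards [hS] with t ht using hN t ht s hs
  have hNu : ∀ᶠ t in L, (N t : Measure (Fin m → I)).real univ = Fn t 0 := by
    filter_upwards [hNs (fun _ => 0) fun _ => le_rfl] with t ht
    simp only [h.pt_zero, Finset.sum_const_zero] at ht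
    rw [← ht]
    congr 1
    exact (eq_univ_of_forall fun u => mem_Iic.2 fun i => (le_top : u i ≤ ⊤)).symm
  have hF0 : 0 ≤ F 0 := ge_of_tendsto (hlim 0 le_rfl) (hNu.mono fun t ht => by
    rw [← ht]; exact measureReal_nonneg)
  have hmass : ∀ᶠ t in L, N t ∈ {ν : FiniteMeasure (Fin m → I) | ν.mass ≤ (F 0 + 1).toNNReal} := by
    filter_upwards [hNu, (hlim 0 le_rfl).eventually_le_const (lt_add_one (F 0))] with t ht ht'
    rw [← NNReal.coe_le_coe, Real.coe_toNNReal _ (by linarith)]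
    exact ht.le.trans ht'
  -- Bounded total masses on a compact space give weak compactness; an ultrafilter finer than `L`
  -- replaces the choice of a subsequence.
  obtain ⟨ν, -, hν⟩ := (isCompact_setOfPred_finiteMeasure_le_of_compactSpace (Fin m → I)
    (F 0 + 1).toNNReal).ultrafilter_le_nhds ((Ultrafilter.of L).map N) (by
      rw [le_principal_iff]
      exact Ultrafilter.of_le L hmass)
  have hUL : ((Ultrafilter.of L : Ultrafilter ℝ) : Filter ℝ) ≤ L := Ultrafilter.of_le L
  have hνt : Tendsto N (Ultrafilter.of L : Filter ℝ) (𝓝 ν) := hν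
  have hclosed : ∀ (K : Set (Fin m → I)) (a : ℝ → ℝ) (b : ℝ), IsClosed K →
      Tendsto a L (𝓝 b) → (∀ᶠ t in L, a t ≤ (N t : Measure (Fin m → I)).real K) →
      b ≤ (ν : Measure (Fin m → I)).real K := by
    intro K a b hK hab hle
    have h1 := FiniteMeasure.limsup_measure_closed_le_of_tendsto hνt hK
    have h2 : Tendsto (fun t => ENNReal.ofReal (a t)) (Ultrafilter.of L : Filter ℝ)
        (𝓝 (ENNReal.ofReal b)) := (ENNReal.continuous_ofReal.tendsto b).comp (hab.mono_left hUL)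
    have h3 : ENNReal.ofReal b ≤ (ν : Measure (Fin m → I)) K := by
      rw [← h2.limsup_eq]
      refine (limsup_le_limsup ?_).trans h1
      filter_upwards [hUL hle] with t ht
      exact ENNReal.ofReal_le_of_le_toReal ht
    exact (ENNReal.ofReal_le_iff_le_toReal (measure_ne_top _ _)).1 h3
  have hmassν : (ν : Measure (Fin m → I)).real univ = F 0 := by
    have h1 : Tendsto (fun t => (N t : Measure (Fin m → I)).real univ)
        (Ultrafilter.of L : Filter ℝ) (𝓝 ((ν : Measure (Fin m → I)).real univ)) :=
      (NNReal.continuous_coe.comp FiniteMeasure.continuous_mass).continuousAt.tendsto.comp hνt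
    refine tendsto_nhds_unique h1 (((hlim 0 le_rfl).mono_left hUL).congr' ?_)
    filter_upwards [hUL hNu] with t ht using ht.symm
  have hlow : ∀ s : Fin m → ℝ, (∀ i, 0 ≤ s i) →
      F (∑ i, s i) ≤ (ν : Measure (Fin m → I)).real (Iic fun i => pt ψ (s i)) := by
    intro s hs
    refine hclosed _ _ _ isClosed_Iic (hlim _ (Finset.sum_nonneg fun i _ => hs i)) ?_
    filter_upwards [hNs s hs] with t ht using ht.ge
  -- The upper bound applies the closed-set inequality to the closure of the complement of a larger
  -- box, whose interior contains the given box.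
  have hupp : ∀ s s' : Fin m → ℝ, (∀ i, 0 ≤ s' i) →
      (∀ i, s' i = 0 ∨ pt ψ (s i) < pt ψ (s' i)) →
      (ν : Measure (Fin m → I)).real (Iic fun i => pt ψ (s i)) ≤ F (∑ i, s' i) := by
    intro s s' hs' hss
    have h1 : F 0 - F (∑ i, s' i) ≤
        (ν : Measure (Fin m → I)).real (closure (Iic fun i => pt ψ (s' i))ᶜ) := by
      refine hclosed _ _ _ isClosed_closure ((hlim 0 le_rfl).sub
        (hlim _ (Finset.sum_nonneg fun i _ => hs' i))) ?_
      filter_upwards [hNs s' hs', hNu] with t ht ht'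
      rw [← ht, ← ht', ← measureReal_compl measurableSet_Iic]
      exact measureReal_mono subset_closure
    have h2 := measureReal_compl (μ := (ν : Measure (Fin m → I)))
      (isClosed_closure (s := (Iic fun i => pt ψ (s' i))ᶜ)).measurableSet
    rw [closure_compl, compl_compl] at h2
    have h3 := measureReal_mono (μ := (ν : Measure (Fin m → I)))
      (Iic_pt_subset_interior hss h)
    rw [closure_compl] at h1
    linarith
  refine ⟨ν, inferInstance, fun s hs => le_antisymm ?_ (hlow s hs)⟩
  by_cases hpos : ∀ i, 0 < ψ (s i)
  · have hsum : 0 ≤ ∑ i, s i := Finset.sum_nonneg fun i _ => hs i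
    -- Scaling `s` by `t < 1` strictly enlarges the box in every coordinate with `s i > 0`; left
    -- continuity of `F` then lets `t` tend to 1.
    have hev : ∀ᶠ t : ℝ in 𝓝[<] 1,
        (ν : Measure (Fin m → I)).real (Iic fun i => pt ψ (s i)) ≤ F (t * ∑ i, s i) := by
      filter_upwards [Ioo_mem_nhdsLT zero_lt_one] with t ht
      rw [Finset.mul_sum]
      refine hupp s _ (fun i => mul_nonneg ht.1.le (hs i)) fun i => ?_
      rcases (hs i).eq_or_lt with hi | hi
      · left; rw [← hi, mul_zero]
      · right
        have h1 : 0 ≤ t * s i := mul_nonneg ht.1.le (hs i)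
        have h2 : t * s i < s i := mul_lt_of_lt_one_left hi ht.2
        rw [← Subtype.coe_lt_coe, h.coe_pt (hs i), h.coe_pt h1]
        exact h.lt_of_lt h1 h2 ((hpos i).trans_le (h.antitoneOn h1 (hs i) h2.le))
    refine ge_of_tendsto ?_ hev
    rcases hsum.eq_or_lt with h0 | h0
    · simp [← h0]
    · refine (hcont _ h0).tendsto.comp (tendsto_nhdsWithin_iff.2 ⟨?_, ?_⟩)
      · have : Tendsto (fun t : ℝ => t * ∑ i, s i) (𝓝 1) (𝓝 (1 * ∑ i, s i)) :=
          (continuous_mul_const _).tendsto 1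
        rw [one_mul] at this
        exact this.mono_left nhdsWithin_le_nhds
      · filter_upwards [self_mem_nhdsWithin] with t ht
        exact mul_le_of_le_one_left h0.le (le_of_lt ht)
  -- For `ψ (s i) = 0` scaling need not enlarge the box strictly. Instead the box is compared with
  -- one constrained only in coordinate `i`, at a level `r` with `ψ r > 0` and `F r = 0`, which
  -- forces mass zero.
  · push Not at hpos
    obtain ⟨i, hi⟩ := hpos
    obtain ⟨r, hr, hrpos, hFr⟩ := hz (s i) (hs i) (le_antisymm hi (h.nonneg (hs i)))
    have h1 := hupp s (Pi.single i r) (fun j => by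
      rcases eq_or_ne j i with rfl | hj
      · simpa using hr
      · simp [hj]) fun j => by
      rcases eq_or_ne j i with rfl | hj
      · right
        rw [← Subtype.coe_lt_coe, Pi.single_eq_same, h.coe_pt (hs _), h.coe_pt hr]
        exact hi.trans_lt hrpos
      · left; simp [hj]
    rw [Finset.sum_pi_single' i r] at h1
    simp only [Finset.mem_univ, if_true, hFr] at h1
    refine h1.trans ?_
    refine ge_of_tendsto (hlim _ (Finset.sum_nonneg fun i _ => hs i)) ?_
    filter_upwards [hNs s hs] with t ht
    rw [← ht]
    exact measureReal_nonneg

end Surv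

/-! ### Convex functions on the open half-line -/

/-- The negative of the left-hand derivative. -/
noncomputable def negLeftDeriv (f : ℝ → ℝ) (z : ℝ) : ℝ := -leftDeriv f z

section Convex

variable {f : ℝ → ℝ}

lemma measurable_leftDeriv (f : ℝ → ℝ) : Measurable (leftDeriv f) := by
  have h : leftDeriv f = fun z => -derivWithin (fun x => f (-x)) (Ici (-z)) (-z) := by
    ext z
    rw [leftDeriv, derivWithin_comp_neg]
    simp
  rw [h]
  exact ((measurable_derivWithin_Ici _).comp measurable_neg).neg

lemma measurable_negLeftDeriv (f : ℝ → ℝ) : Measurable (negLeftDeriv f) :=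
  (measurable_leftDeriv f).neg

/-- Antitone increments give midpoint convexity. Subtract the chord and take a maximum `c` of the
difference `p` on `[x, y]`: the largest symmetric step around `c` reaches an endpoint, where `p =
0`, while the other end is at most `p c`, so `p c ≤ 0`. -/
lemma convexOn_of_antitoneOn_sub (hc : ContinuousOn f (Ioi 0))
    (ha : ∀ h, 0 < h → AntitoneOn (fun x => f x - f (x + h)) (Ioi 0)) :
    ConvexOn ℝ (Ioi 0) f := by
  refine LinearOrder.convexOn_of_lt (convex_Ioi 0) fun x hx y hy hxy a b hpa hpb hab => ?_
  set k := (f y - f x) / (y - x) with hk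
  have hyx : y - x ≠ 0 := (sub_pos.2 hxy).ne'
  have hky : (y - x) * k = f y - f x := by rw [hk]; field_simp
  set p : ℝ → ℝ := fun t => f t - (f x + (t - x) * k) with hp
  have hpc : ContinuousOn p (Icc x y) :=
    (hc.mono fun t ht => lt_of_lt_of_le hx ht.1).sub (by fun_prop)
  obtain ⟨c, hcm, hmax⟩ := isCompact_Icc.exists_isMaxOn (nonempty_Icc.2 hxy.le) hpc
  have hpx : p x = 0 := by simp [hp]
  have hpy : p y = 0 := by simp only [hp, hky]; ring
  have hpc0 : p c ≤ 0 := by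
    rcases hcm.1.eq_or_lt with h1 | h1
    · rw [← h1, hpx]
    rcases hcm.2.eq_or_lt with h2 | h2
    · rw [h2, hpy]
    have key : ∀ δ, 0 < δ → δ ≤ c - x → δ ≤ y - c → 2 * p c ≤ p (c - δ) + p (c + δ) := by
      intro δ hδ h3 h4
      have h5 : 0 < c - δ := lt_of_lt_of_le hx (by linarith)
      have := ha δ hδ (mem_Ioi.2 h5) (mem_Ioi.2 (lt_trans hx h1)) (by linarith)
      simp only [sub_add_cancel] at this
      simp only [hp]
      linarith
    rcases le_total (c - x) (y - c) with h3 | h3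
    · have h4 := key (c - x) (by linarith) le_rfl h3
      have h5 : p (c + (c - x)) ≤ p c := hmax ⟨by linarith, by linarith⟩
      rw [sub_sub_cancel, hpx] at h4
      linarith
    · have h4 := key (y - c) (by linarith) h3 le_rfl
      have h5 : p (c - (y - c)) ≤ p c := hmax ⟨by linarith, by linarith⟩
      rw [add_sub_cancel, hpy] at h4
      linarith
  have hw : a • x + b • y ∈ Icc x y :=
    convex_Icc x y (left_mem_Icc.2 hxy.le) (right_mem_Icc.2 hxy.le) hpa.le hpb.le hab
  have h6 : p (a • x + b • y) ≤ 0 := (hmax hw).trans hpc0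
  have h7 : (a • x + b • y - x) * k = b * (f y - f x) := by
    rw [← hky, show a = 1 - b by linarith]
    simp only [smul_eq_mul]
    ring
  simp only [hp] at h6
  rw [h7] at h6
  simp only [smul_eq_mul] at h6 ⊢
  rw [show a = 1 - b by linarith] at h6 ⊢
  linarith

lemma _root_.ConvexOn.hasDerivWithinAt_negLeftDeriv (hf : ConvexOn ℝ (Ioi 0) f) {z : ℝ}
    (hz : 0 < z) : HasDerivWithinAt f (-negLeftDeriv f z) (Iic z) z := by
  rw [negLeftDeriv, neg_neg]
  have := hf.differentiableWithinAt_Iio_of_mem_interior (x := z) (by rwa [interior_Ioi])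
  exact (hasDerivWithinAt_Iio_iff_Iic.1 this.hasDerivWithinAt).differentiableWithinAt.hasDerivWithinAt

lemma _root_.ConvexOn.negLeftDeriv_mul_le (hf : ConvexOn ℝ (Ioi 0) f) {x y : ℝ}
    (hx : 0 < x) (hxy : x < y) : negLeftDeriv f y * (y - x) ≤ f x - f y := by
  have hy := hx.trans hxy
  have h1 := hf.slope_le_of_hasDerivWithinAt_Iio hx hy hxy
    ((hf.hasDerivWithinAt_negLeftDeriv hy).mono Iio_subset_Iic_self)
  rw [slope_def_field, div_le_iff₀ (sub_pos.2 hxy)] at h1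
  linarith

lemma _root_.ConvexOn.le_negLeftDeriv_mul (hf : ConvexOn ℝ (Ioi 0) f) {y w : ℝ}
    (hy : 0 < y) (hyw : y < w) : f y - f w ≤ negLeftDeriv f y * (w - y) := by
  have hyi : y ∈ interior (Ioi (0 : ℝ)) := by rwa [interior_Ioi]
  have h1 := hf.rightDeriv_le_slope_of_mem_interior hyi (mem_Ioi.2 (hy.trans hyw)) hyw
  have h2 := hf.leftDeriv_le_rightDeriv_of_mem_interior hyi
  have h3 := ((hf.hasDerivWithinAt_negLeftDeriv hy).mono Iio_subset_Iic_self).derivWithin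
    (uniqueDiffWithinAt_Iio y)
  rw [h3] at h2
  have h4 := h2.trans h1
  rw [slope_def_field, le_div_iff₀ (sub_pos.2 hyw)] at h4
  linarith

lemma _root_.ConvexOn.antitoneOn_negLeftDeriv (hf : ConvexOn ℝ (Ioi 0) f) :
    AntitoneOn (negLeftDeriv f) (Ioi 0) := by
  intro x hx y hy hxy
  rcases hxy.eq_or_lt with rfl | hlt
  · rfl
  have h1 := hf.negLeftDeriv_mul_le hx hlt
  have h2 := hf.le_negLeftDeriv_mul hx hlt
  exact le_of_mul_le_mul_right (h1.trans h2) (sub_pos.2 hlt)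

lemma _root_.ConvexOn.tendsto_negLeftDeriv (hf : ConvexOn ℝ (Ioi 0) f) {z : ℝ} (hz : 0 < z) :
    Tendsto (fun h => h⁻¹ * (f (z - h) - f z)) (𝓝[>] 0) (𝓝 (negLeftDeriv f z)) := by
  have h1 := ((hf.hasDerivWithinAt_negLeftDeriv hz).mono Iio_subset_Iic_self)
  rw [hasDerivWithinAt_iff_tendsto_slope' self_notMem_Iio] at h1
  have h2 : Tendsto (fun h : ℝ => z - h) (𝓝[>] 0) (𝓝[<] z) := by
    refine tendsto_nhdsWithin_iff.2 ⟨?_, ?_⟩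
    · have : Tendsto (fun h : ℝ => z - h) (𝓝 0) (𝓝 (z - 0)) :=
        (continuous_const.sub continuous_id).tendsto 0
      rw [sub_zero] at this
      exact this.mono_left nhdsWithin_le_nhds
    · filter_upwards [self_mem_nhdsWithin] with h hh
      exact sub_lt_self z hh
  have h3 := (h1.comp h2).neg
  rw [neg_neg] at h3
  refine h3.congr fun h => ?_
  rw [Function.comp, slope_def_field, sub_sub_cancel_left, div_neg, neg_neg, div_eq_inv_mul]

/-- Monotonicity gives the lower bound. For the upper bound, a backward difference quotient at `z`
close to the derivative stays close when its right endpoint moves to `w`, and it dominates the value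
at `w`. -/
lemma _root_.ConvexOn.continuousWithinAt_negLeftDeriv (hf : ConvexOn ℝ (Ioi 0) f) {z : ℝ}
    (hz : 0 < z) : ContinuousWithinAt (negLeftDeriv f) (Iic z) z := by
  have hfc : ContinuousAt f z := (hf.continuousOn isOpen_Ioi).continuousAt (Ioi_mem_nhds hz)
  refine tendsto_order.2 ⟨fun a ha => ?_, fun a ha => ?_⟩
  · filter_upwards [self_mem_nhdsWithin, mem_nhdsWithin_of_mem_nhds (Ioi_mem_nhds hz)] with w hw hw0
    exact ha.trans_le (hf.antitoneOn_negLeftDeriv hw0 hz hw)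
  · obtain ⟨h, hh, hh0⟩ := (((hf.tendsto_negLeftDeriv hz).eventually_lt_const ha).and
      (Ioo_mem_nhdsGT hz)).exists
    have h1 : Tendsto (fun w => (w - (z - h))⁻¹ * (f (z - h) - f w)) (𝓝 z)
        (𝓝 ((z - (z - h))⁻¹ * (f (z - h) - f z))) :=
      ((continuousAt_id.sub continuousAt_const).inv₀ (by simpa using hh0.1.ne')).mul
        (continuousAt_const.sub hfc)
    rw [sub_sub_cancel] at h1
    filter_upwards [mem_nhdsWithin_of_mem_nhds (h1.eventually_lt_const hh),
      mem_nhdsWithin_of_mem_nhds (Ioi_mem_nhds (sub_lt_self z hh0.1))] with w hw hw0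
    have hw0' : z - h < w := hw0
    refine lt_of_le_of_lt ?_ hw
    rw [← div_eq_inv_mul, le_div_iff₀ (sub_pos.2 hw0)]
    exact hf.negLeftDeriv_mul_le (sub_pos.2 hh0.2) hw0

lemma _root_.ConvexOn.negLeftDeriv_nonneg (hf : ConvexOn ℝ (Ioi 0) f) (ha : AntitoneOn f (Ioi 0))
    {z : ℝ} (hz : 0 < z) : 0 ≤ negLeftDeriv f z := by
  have h1 := hf.le_negLeftDeriv_mul hz (lt_add_one z)
  rw [add_sub_cancel_left, mul_one] at h1
  linarith [ha hz (mem_Ioi.2 (by linarith : (0 : ℝ) < z + 1)) (by linarith)]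

lemma _root_.ConvexOn.tendsto_negLeftDeriv_atTop (hf : ConvexOn ℝ (Ioi 0) f)
    (ha : AntitoneOn f (Ioi 0)) (h0 : Tendsto f atTop (𝓝 0)) :
    Tendsto (negLeftDeriv f) atTop (𝓝 0) := by
  have h1 : Tendsto (fun z => f (z - 1) - f z) atTop (𝓝 (0 - 0)) :=
    (h0.comp (tendsto_atTop_add_const_right _ (-1) tendsto_id)).sub h0
  rw [sub_zero] at h1
  refine tendsto_of_tendsto_of_tendsto_of_le_of_le' tendsto_const_nhds h1 ?_ ?_
  · filter_upwards [eventually_gt_atTop 0] with z hz using hf.negLeftDeriv_nonneg ha hz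
  · filter_upwards [eventually_gt_atTop 1] with z hz
    have := hf.negLeftDeriv_mul_le (sub_pos.2 hz) (sub_one_lt z)
    rwa [sub_sub_cancel, mul_one] at this

/-- A convex function with zero left derivative at `z` never drops below `f z` afterwards, while it
tends to 0. -/
lemma _root_.ConvexOn.eq_zero_of_negLeftDeriv (hf : ConvexOn ℝ (Ioi 0) f)
    (h0 : Tendsto f atTop (𝓝 0)) {z : ℝ} (hz : 0 < z) (hfz : 0 ≤ f z)
    (hd : negLeftDeriv f z = 0) : f z = 0 := by
  refine le_antisymm (ge_of_tendsto h0 ?_) hfz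
  filter_upwards [eventually_gt_atTop z] with w hw
  have := hf.le_negLeftDeriv_mul hz hw
  rw [hd, zero_mul] at this
  linarith

lemma negLeftDeriv_eq_zero {z : ℝ} (h : ∀ w, z < w → f w = 0) {w : ℝ} (hw : z < w) :
    negLeftDeriv f w = 0 := by
  have h1 : f =ᶠ[𝓝 w] fun _ => 0 := by
    filter_upwards [Ioi_mem_nhds hw] with v hv using h v hv
  rw [negLeftDeriv, leftDeriv, (h1.filter_mono nhdsWithin_le_nhds).derivWithin_eq h1.self_of_nhds]
  simp

lemma hasDerivWithinAt_comp_add_const {a w c : ℝ} {S T : Set ℝ}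
    (h : HasDerivWithinAt f c S (w + a)) (hT : ∀ x ∈ T, x + a ∈ S) :
    HasDerivWithinAt (fun x => f (x + a)) c T w := by
  have h1 : HasDerivWithinAt (fun x : ℝ => x + a) 1 T w :=
    ((hasDerivAt_id w).add_const a).hasDerivWithinAt
  have h2 := HasDerivWithinAt.comp w h h1 hT
  rwa [mul_one] at h2

/-- A convex function on the half-line all of whose backward increments are convex is
differentiable. -/
lemma _root_.ConvexOn.differentiableAt_of_convexOn_sub (hf : ConvexOn ℝ (Ioi 0) f)
    (hd : ∀ h, 0 < h → ConvexOn ℝ (Ioi 0) fun x => f x - f (x + h)) {z : ℝ} (hz : 0 < z) :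
    DifferentiableAt ℝ f z := by
  have hR : ∀ x, 0 < x → HasDerivWithinAt f (derivWithin f (Ioi x) x) (Ioi x) x := fun x hx =>
    hf.hasDerivWithinAt_rightDeriv_of_mem_interior (by rwa [interior_Ioi])
  have hL : ∀ x, 0 < x → HasDerivWithinAt f (-negLeftDeriv f x) (Iio x) x := fun x hx =>
    (hf.hasDerivWithinAt_negLeftDeriv hx).mono Iio_subset_Iic_self
  -- The one-sided derivatives agree wherever the monotone left derivative is continuous, hence off
  -- a countable set; such a point exists below `z`.
  obtain ⟨w, hw, hwz, hwc⟩ : ∃ w, 0 < w ∧ w < z ∧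
      ContinuousWithinAt (negLeftDeriv f) (Ioi 0) w := by
    have hcount := hf.antitoneOn_negLeftDeriv.countable_not_continuousWithinAt
    obtain ⟨w, hw, hwz⟩ := (hcount.dense_compl ℝ).exists_between hz
    refine ⟨w, hwz.1, hwz.2, ?_⟩
    by_contra hcon
    exact hw ⟨hwz.1, hcon⟩
  have hjw : derivWithin f (Ioi w) w ≤ -negLeftDeriv f w := by
    have h1 : Tendsto (fun y => -negLeftDeriv f y) (𝓝[>] w) (𝓝 (-negLeftDeriv f w)) :=
      (hwc.mono (Ioi_subset_Ioi hw.le)).neg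
    refine ge_of_tendsto h1 ?_
    filter_upwards [self_mem_nhdsWithin] with y hy
    have hy : w < y := hy
    exact (hf.le_slope_of_hasDerivWithinAt_Ioi hw (hw.trans hy) hy (hR w hw)).trans
      (hf.slope_le_of_hasDerivWithinAt_Iio hw (hw.trans hy) hy (hL y (hw.trans hy)))
  -- Convexity at `w` of the increment of length `z - w` says that the derivative jump of `f` at `z`
  -- is at most its jump at `w`, which is not positive.
  have hjz : derivWithin f (Ioi z) z ≤ -negLeftDeriv f z := by
    have hh : 0 < z - w := sub_pos.2 hwz
    have hwi : w ∈ interior (Ioi (0 : ℝ)) := by rwa [interior_Ioi]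
    have hwz' : w + (z - w) = z := add_sub_cancel w z
    have h1 := (hd _ hh).leftDeriv_le_rightDeriv_of_mem_interior hwi
    have hRz : HasDerivWithinAt (fun x => f (x + (z - w))) (derivWithin f (Ioi z) z) (Ioi w) w := by
      refine hasDerivWithinAt_comp_add_const (by rw [hwz']; exact hR z hz) fun x hx => ?_
      rw [mem_Ioi] at hx ⊢
      linarith
    have hLz : HasDerivWithinAt (fun x => f (x + (z - w))) (-negLeftDeriv f z) (Iio w) w := by
      refine hasDerivWithinAt_comp_add_const (by rw [hwz']; exact hL z hz) fun x hx => ?_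
      rw [mem_Iio] at hx ⊢
      linarith
    rw [((hL w hw).fun_sub hLz).derivWithin (uniqueDiffWithinAt_Iio w),
      ((hR w hw).fun_sub hRz).derivWithin (uniqueDiffWithinAt_Ioi w)] at h1
    linarith
  have hle := hf.leftDeriv_le_rightDeriv_of_mem_interior (x := z) (by rwa [interior_Ioi])
  rw [(hL z hz).derivWithin (uniqueDiffWithinAt_Iio z)] at hle
  have heq := le_antisymm hjz hle
  have h1 := hasDerivWithinAt_Ioi_iff_Ici.1 (hR z hz)
  rw [heq] at h1
  have h2 := (hf.hasDerivWithinAt_negLeftDeriv hz).union h1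
  rw [Iic_union_Ici, hasDerivWithinAt_univ] at h2
  exact h2.differentiableAt

/-- Reflection `x ↦ -x` turns left derivatives into right derivatives, for which the fundamental
theorem of calculus needs no two-sided differentiability. -/
lemma _root_.ConvexOn.lintegral_Ioc_negLeftDeriv (hf : ConvexOn ℝ (Ioi 0) f)
    (ha : AntitoneOn f (Ioi 0)) {a R : ℝ} (h0 : 0 < a) (haR : a ≤ R) :
    ∫⁻ r in Ioc a R, ENNReal.ofReal (negLeftDeriv f r) = ENNReal.ofReal (f a - f R) := by
  have hsub : Icc a R ⊆ Ioi 0 := fun x hx => lt_of_lt_of_le h0 hx.1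
  have hint : IntegrableOn (negLeftDeriv f) (Icc a R) :=
    (hf.antitoneOn_negLeftDeriv.mono hsub).integrableOn_isCompact isCompact_Icc
  have hcont : ContinuousOn (fun x => f (-x)) (Icc (-R) (-a)) :=
    ((hf.continuousOn isOpen_Ioi).mono hsub).comp continuousOn_neg fun x hx =>
      ⟨by linarith [hx.2], by linarith [hx.1]⟩
  have hder : ∀ x ∈ Ioo (-R) (-a),
      HasDerivWithinAt (fun x => f (-x)) (negLeftDeriv f (-x)) (Ioi x) x := by
    intro x hx
    have hx0 : 0 < -x := by linarith [hx.2]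
    have h1 := ((hf.hasDerivWithinAt_negLeftDeriv hx0).mono Iio_subset_Iic_self).scomp x
      (hasDerivAt_neg x).hasDerivWithinAt (s := Ioi x) fun y hy => mem_Iio.2 (neg_lt_neg hy)
    simpa [Function.comp_def] using h1
  have hint' : IntervalIntegrable (fun x => negLeftDeriv f (-x)) volume (-R) (-a) := by
    refine MonotoneOn.intervalIntegrable fun x hx y hy hxy => ?_
    rw [uIcc_of_le (neg_le_neg haR)] at hx hy
    refine hf.antitoneOn_negLeftDeriv (mem_Ioi.2 ?_) (mem_Ioi.2 ?_) (neg_le_neg hxy)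
    · linarith [hy.2]
    · linarith [hx.2]
  have h3 := intervalIntegral.integral_eq_sub_of_hasDeriv_right_of_le (neg_le_neg haR) hcont hder
    hint'
  rw [intervalIntegral.integral_comp_neg (fun x => negLeftDeriv f x), neg_neg, neg_neg,
    intervalIntegral.integral_of_le haR] at h3
  rw [← h3, ofReal_integral_eq_lintegral_ofReal (hint.mono_set Ioc_subset_Icc_self)]
  filter_upwards [ae_restrict_mem measurableSet_Ioc] with x hx
  exact hf.negLeftDeriv_nonneg ha (h0.trans hx.1)

lemma _root_.ConvexOn.lintegral_Ioi_negLeftDeriv (hf : ConvexOn ℝ (Ioi 0) f)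
    (ha : AntitoneOn f (Ioi 0)) (htop : Tendsto f atTop (𝓝 0)) {a : ℝ} (h0 : 0 ≤ a)
    (hfa : ContinuousWithinAt f (Ioi a) a) :
    ∫⁻ r in Ioi a, ENNReal.ofReal (negLeftDeriv f r) = ENNReal.ofReal (f a) := by
  have hcov : AECover (volume.restrict (Ioi a)) atTop
      fun n : ℕ => Ioi (a + 1 / ((n : ℝ) + 1)) ∩ Iic (a + 1 + n) := by
    refine AECover.inter (aecover_Ioi_of_Ioi ?_) ((aecover_Iic ?_).mono
      Measure.restrict_le_self)
    · simpa using (tendsto_one_div_add_atTop_nhds_zero_nat (𝕜 := ℝ)).const_add a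
    · exact tendsto_atTop_add_const_left _ _ tendsto_natCast_atTop_atTop
  refine hcov.lintegral_eq_of_tendsto _ (measurable_negLeftDeriv f).ennreal_ofReal.aemeasurable ?_
  have hpos : ∀ n : ℕ, 0 < 1 / ((n : ℝ) + 1) := fun n => by positivity
  have h1 : ∀ n : ℕ, ∫⁻ r in Ioi (a + 1 / ((n : ℝ) + 1)) ∩ Iic (a + 1 + n),
      ENNReal.ofReal (negLeftDeriv f r) ∂(volume.restrict (Ioi a)) =
        ENNReal.ofReal (f (a + 1 / ((n : ℝ) + 1)) - f (a + 1 + n)) := by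
    intro n
    rw [Ioi_inter_Iic, Measure.restrict_restrict measurableSet_Ioc, inter_eq_left.2,
      hf.lintegral_Ioc_negLeftDeriv ha (by linarith [hpos n])]
    · have : 1 / ((n : ℝ) + 1) ≤ 1 := by
        rw [div_le_one (by positivity)]
        linarith [(Nat.cast_nonneg n : (0 : ℝ) ≤ n)]
      linarith [(Nat.cast_nonneg n : (0 : ℝ) ≤ n)]
    · exact fun x hx => lt_trans (by linarith [hpos n]) hx.1
  simp_rw [h1]
  refine (ENNReal.continuous_ofReal.tendsto _).comp ?_
  rw [show f a = f a - 0 by simp]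
  refine Tendsto.sub (hfa.tendsto.comp (tendsto_nhdsWithin_iff.2 ⟨?_, ?_⟩)) (htop.comp ?_)
  · simpa using (tendsto_one_div_add_atTop_nhds_zero_nat (𝕜 := ℝ)).const_add a
  · exact Eventually.of_forall fun n => by simpa using hpos n
  · exact tendsto_atTop_add_const_left _ _ tendsto_natCast_atTop_atTop

end Convex

/-! ### Regularity of the generator -/

/-- The functions `(-1)^k ψ^(k)`, where all derivatives are taken from the left. -/
noncomputable def altDeriv (ψ : ℝ → ℝ) : ℕ → ℝ → ℝ
  | 0 => ψ
  | k + 1 => negLeftDeriv (altDeriv ψ k)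

/-- Arbitrarily close to `0` the function `f` has shifts which are survival functions in dimension
`m`. -/
def ShiftSurv (ψ : ℝ → ℝ) (m : ℕ) (f : ℝ → ℝ) : Prop :=
  ∀ z, 0 < z → ∃ z₀, 0 ≤ z₀ ∧ z₀ < z ∧ Surv ψ m fun r => f (z₀ + r)

section Regularity

variable {ψ f : ℝ → ℝ} {m d : ℕ}

lemma ShiftSurv.antitoneOn (h : IsGenerator ψ) (hf : ShiftSurv ψ (m + 1) f) :
    AntitoneOn f (Ioi 0) := by
  intro x hx y hy hxy
  obtain ⟨z, hz, hzx, hS⟩ := hf x hx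
  have := hS.antitoneOn h (mem_Ici.2 (sub_nonneg.2 hzx.le))
    (mem_Ici.2 (sub_nonneg.2 (hzx.le.trans hxy))) (sub_le_sub_right hxy z)
  simpa using this

lemma ShiftSurv.nonneg (hf : ShiftSurv ψ (m + 1) f) {x : ℝ} (hx : 0 < x) : 0 ≤ f x := by
  obtain ⟨z, hz, hzx, hS⟩ := hf x hx
  simpa using hS.nonneg (sub_nonneg.2 hzx.le)

lemma ShiftSurv.sub (h : IsGenerator ψ) (hf : ShiftSurv ψ (m + 1) f) {a : ℝ} (ha : 0 < a) :
    ShiftSurv ψ m fun x => f x - f (x + a) := by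
  intro x hx
  obtain ⟨z, hz, hzx, hS⟩ := hf x hx
  refine ⟨z, hz, hzx, (hS.diff h le_rfl ha.le).congr fun r _ => ?_⟩
  simp only [zero_add, add_assoc, add_comm r a]

lemma ShiftSurv.convexOn (h : IsGenerator ψ) (hf : ShiftSurv ψ (m + 2) f)
    (hc : ContinuousOn f (Ioi 0)) : ConvexOn ℝ (Ioi 0) f :=
  convexOn_of_antitoneOn_sub hc fun _ ha => (hf.sub h ha).antitoneOn h

lemma ShiftSurv.convexOn_sub (h : IsGenerator ψ) (hf : ShiftSurv ψ (m + 3) f)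
    (hc : ContinuousOn f (Ioi 0)) {a : ℝ} (ha : 0 < a) :
    ConvexOn ℝ (Ioi 0) fun x => f x - f (x + a) :=
  (hf.sub h ha).convexOn h (hc.sub (hc.comp (by fun_prop) fun _ hx => add_pos hx ha))

lemma ShiftSurv.differentiableAt (h : IsGenerator ψ) (hf : ShiftSurv ψ (m + 3) f)
    (hc : ContinuousOn f (Ioi 0)) {z : ℝ} (hz : 0 < z) : DifferentiableAt ℝ f z :=
  (ShiftSurv.convexOn (m := m + 1) h hf hc).differentiableAt_of_convexOn_sub
    (fun _ ha => hf.convexOn_sub h hc ha) hz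

lemma hasDerivAt_neg_negLeftDeriv {z : ℝ} (hd : DifferentiableAt ℝ f z) :
    HasDerivAt f (-negLeftDeriv f z) z := by
  rw [negLeftDeriv, neg_neg, leftDeriv, hd.derivWithin (uniqueDiffWithinAt_Iic z)]
  exact hd.hasDerivAt

/-- Minus the derivative is a pointwise limit of difference quotients, each a positive multiple of a
convex increment. Convexity supplies the continuity needed at the next order of differentiation. -/
lemma convexOn_negLeftDeriv (hd : ∀ z, 0 < z → DifferentiableAt ℝ f z)
    (hs : ∀ a, 0 < a → ConvexOn ℝ (Ioi 0) fun x => f x - f (x + a)) :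
    ConvexOn ℝ (Ioi 0) (negLeftDeriv f) := by
  have hlim : ∀ z, 0 < z →
      Tendsto (fun a => a⁻¹ * (f z - f (z + a))) (𝓝[>] 0) (𝓝 (negLeftDeriv f z)) := by
    intro z hz
    have h1 := (hasDerivAt_neg_negLeftDeriv (hd z hz)).tendsto_slope_zero_right.neg
    rw [neg_neg] at h1
    refine h1.congr fun a => ?_
    rw [smul_eq_mul, ← mul_neg, neg_sub]
  refine ⟨convex_Ioi 0, fun x hx y hy a b ha hb hab => ?_⟩
  refine le_of_tendsto_of_tendsto (hlim _ (convex_Ioi 0 hx hy ha hb hab))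
    (((hlim x hx).const_smul a).add ((hlim y hy).const_smul b)) ?_
  filter_upwards [self_mem_nhdsWithin] with t ht
  have h1 := mul_le_mul_of_nonneg_left ((hs t ht).2 hx hy ha hb hab)
    (inv_nonneg.2 (le_of_lt (mem_Ioi.1 ht)))
  simp only [smul_eq_mul] at h1 ⊢
  linarith

lemma ShiftSurv.surv_negLeftDeriv (h : IsGenerator ψ) (hf : ShiftSurv ψ (m + 1) f)
    (hconv : ConvexOn ℝ (Ioi 0) f) (h0 : ∀ s, 0 < s → ψ s = 0 → ∀ w, s < w → f w = 0) {z : ℝ}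
    (hz : 0 < z) : Surv ψ m fun r => negLeftDeriv f (z + r) := by
  obtain ⟨z₀, hz₀, hzz, hS⟩ := hf z hz
  refine Surv.of_tendsto h (L := 𝓝[>] 0)
    (Fn := fun t r => t⁻¹ * (f (z + r - t) - f (z + r))) ?_ ?_ ?_ ?_
  · filter_upwards [Ioo_mem_nhdsGT (sub_pos.2 hzz)] with t ht
    refine ((hS.diff h (c := z - z₀ - t) (c' := z - z₀) (sub_nonneg.2 ht.2.le)
      (by linarith [ht.1])).const_mul (inv_nonneg.2 ht.1.le)).congr fun r _ => ?_
    congr 3 <;> ring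
  · exact fun r hr => hconv.tendsto_negLeftDeriv (by linarith)
  · intro r hr
    refine (hconv.continuousWithinAt_negLeftDeriv (by linarith : 0 < z + r)).comp
      (by fun_prop) fun x hx => ?_
    exact add_le_add_right hx z
  · intro s hs hs0
    obtain ⟨b, hb, -, hb0, hlt⟩ := h.exists_first_zero hs hs0
    -- Any level in `(b - z, b)` would do when nonnegative: there `ψ` is positive, yet the shift by
    -- `z` lies beyond the first zero `b`.
    refine ⟨max (b - z / 2) 0, le_max_right _ _,
      hlt _ (le_max_right _ _) (max_lt (by linarith) hb), ?_⟩
    exact negLeftDeriv_eq_zero (h0 b hb hb0) (by linarith [le_max_left (b - z / 2) 0])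

/-- The inequality `s < w` must be strict: for `ψ(z) = max(1 - z, 0)` the left derivative at the
zero `1` is `-1`. -/
lemma IsGenerator.altDeriv_eq_zero (h : IsGenerator ψ) (k : ℕ) {s : ℝ} (hs : 0 < s)
    (hs0 : ψ s = 0) : ∀ w, s < w → altDeriv ψ k w = 0 := by
  induction k with
  | zero =>
    exact fun w hw => le_antisymm
      ((h.antitoneOn hs.le (hs.trans hw).le hw.le).trans_eq hs0) (h.nonneg (hs.trans hw).le)
  | succ k ih => exact fun w hw => negLeftDeriv_eq_zero ih hw

/-- The regularity of the functions `(-1)^k ψ^(k)` for `k ≤ d - 2`. -/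
lemma Surv.altDeriv_regular (h : IsGenerator ψ) (hS : Surv ψ d ψ) (k : ℕ) :
    ∀ m, k + m + 2 = d → ShiftSurv ψ (m + 2) (altDeriv ψ k) ∧
      ContinuousOn (altDeriv ψ k) (Ioi 0) ∧ Tendsto (altDeriv ψ k) atTop (𝓝 0) := by
  induction k with
  | zero =>
    intro m hm
    refine ⟨fun z hz => ⟨0, le_rfl, hz, ?_⟩, h.continuousOn.mono Ioi_subset_Ici_self,
      h.tendsto_zero⟩
    rw [show m + 2 = d by omega]
    exact hS.congr fun r _ => by rw [zero_add]; rfl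
  | succ k ih =>
    intro m hm
    obtain ⟨h1, h2, h3⟩ := ih (m + 1) (by omega)
    have hconv : ConvexOn ℝ (Ioi 0) (altDeriv ψ k) := h1.convexOn h h2
    -- A positive shift is needed because derivatives of `ψ` may be unbounded near 0; this is why
    -- the induction carries `ShiftSurv`.
    refine ⟨fun z hz => ⟨z / 2, by linarith, by linarith, ?_⟩, ?_, ?_⟩
    · exact ShiftSurv.surv_negLeftDeriv (m := m + 2) h h1 hconv
        (fun s hs hs0 => h.altDeriv_eq_zero k hs hs0) (half_pos hz)
    · exact (convexOn_negLeftDeriv (fun z hz => ShiftSurv.differentiableAt (m := m) h h1 h2 hz)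
        fun a ha => ShiftSurv.convexOn_sub (m := m) h h1 h2 ha).continuousOn isOpen_Ioi
    · exact hconv.tendsto_negLeftDeriv_atTop (ShiftSurv.antitoneOn (m := m + 2) h h1) h3

lemma Surv.convexOn_altDeriv (h : IsGenerator ψ) (hS : Surv ψ d ψ) {k : ℕ} (hk : k + 2 ≤ d) :
    ConvexOn ℝ (Ioi 0) (altDeriv ψ k) := by
  obtain ⟨m, rfl⟩ := Nat.exists_eq_add_of_le' hk
  obtain ⟨h1, h2, -⟩ := hS.altDeriv_regular h k m (by omega)
  exact h1.convexOn h h2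

lemma Surv.antitoneOn_altDeriv (h : IsGenerator ψ) (hS : Surv ψ d ψ) {k : ℕ} (hk : k + 1 ≤ d) :
    AntitoneOn (altDeriv ψ k) (Ioi 0) := by
  cases k with
  | zero => exact h.antitoneOn.mono Ioi_subset_Ici_self
  | succ k => exact (hS.convexOn_altDeriv h hk).antitoneOn_negLeftDeriv

lemma Surv.tendsto_altDeriv (h : IsGenerator ψ) (hS : Surv ψ d ψ) {k : ℕ} (hk : k + 1 ≤ d)
    (hd : 2 ≤ d) : Tendsto (altDeriv ψ k) atTop (𝓝 0) := by
  cases k with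
  | zero => exact h.tendsto_zero
  | succ k =>
    obtain ⟨m, rfl⟩ := Nat.exists_eq_add_of_le' hk
    obtain ⟨h1, h2, h3⟩ := hS.altDeriv_regular h k m (by omega)
    exact (h1.convexOn h h2).tendsto_negLeftDeriv_atTop (ShiftSurv.antitoneOn (m := m + 1) h h1) h3

/-- This keeps the denominator of the kernel away from zero. If one derivative vanished at `z`,
convexity and decay to 0 would make the preceding one vanish there too. -/
lemma Surv.altDeriv_pos (h : IsGenerator ψ) (hS : Surv ψ d ψ) {k : ℕ} (hk : k + 1 ≤ d)
    {z : ℝ} (hz : 0 < z) (hpos : 0 < ψ z) : 0 < altDeriv ψ k z := by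
  induction k with
  | zero => exact hpos
  | succ k ih =>
    have hconv := hS.convexOn_altDeriv h hk
    have h1 := ih (by omega)
    refine (hconv.negLeftDeriv_nonneg (hS.antitoneOn_altDeriv h (by omega)) hz).lt_of_ne'
      fun h2 => h1.ne' ?_
    exact hconv.eq_zero_of_negLeftDeriv (hS.tendsto_altDeriv h (by omega) (by omega)) hz h1.le h2

/-- For `1 ≤ k < d` the function `(-1)^k ψ^(k)` shifted by `z > 0` is a survival function in
dimension `d - k`. -/
lemma Surv.surv_altDeriv (h : IsGenerator ψ) {k : ℕ} (hS : Surv ψ (k + 1 + (m + 1)) ψ) {z : ℝ}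
    (hz : 0 < z) : Surv ψ (m + 1) fun r => altDeriv ψ (k + 1) (z + r) := by
  obtain ⟨h1, h2, -⟩ := hS.altDeriv_regular h k m (by omega)
  exact ShiftSurv.surv_negLeftDeriv (m := m + 1) h h1 (h1.convexOn h h2)
    (fun s hs hs0 => h.altDeriv_eq_zero k hs hs0) hz

lemma Surv.differentiableAt_altDeriv (h : IsGenerator ψ) (hS : Surv ψ d ψ) {k : ℕ}
    (hk : k + 3 ≤ d) {z : ℝ} (hz : 0 < z) : DifferentiableAt ℝ (altDeriv ψ k) z := by
  obtain ⟨m, rfl⟩ := Nat.exists_eq_add_of_le' hk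
  obtain ⟨h1, h2, -⟩ := hS.altDeriv_regular h k (m + 1) (by omega)
  exact ShiftSurv.differentiableAt (m := m) h h1 h2 hz

lemma Surv.iteratedDeriv_eq (h : IsGenerator ψ) (hS : Surv ψ d ψ) {k : ℕ} (hk : k + 2 ≤ d) :
    ∀ z, 0 < z → iteratedDeriv k ψ z = (-1) ^ k * altDeriv ψ k z := by
  induction k with
  | zero => intro z _; simp [altDeriv]
  | succ k ih =>
    intro z hz
    have h1 : iteratedDeriv k ψ =ᶠ[𝓝 z] fun x => (-1) ^ k * altDeriv ψ k x := by
      filter_upwards [Ioi_mem_nhds hz] with x hx using ih (by omega) x hx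
    have h2 := hasDerivAt_neg_negLeftDeriv (hS.differentiableAt_altDeriv h (by omega : k + 3 ≤ d) hz)
    rw [iteratedDeriv_succ, h1.deriv_eq, (h2.const_mul _).deriv, pow_succ, altDeriv]
    ring

lemma Surv.contDiffOn (h : IsGenerator ψ) (hS : Surv ψ d ψ) (hd : 2 ≤ d) :
    ContDiffOn ℝ ((d - 2 : ℕ) : WithTop ℕ∞) ψ (Ioi 0) := by
  have heq : ∀ k, k + 2 ≤ d → EqOn (iteratedDerivWithin k ψ (Ioi 0))
      (fun x => (-1) ^ k * altDeriv ψ k x) (Ioi 0) := fun k hk x hx => by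
    rw [iteratedDerivWithin_of_isOpen isOpen_Ioi hx, hS.iteratedDeriv_eq h hk x hx]
  refine contDiffOn_of_continuousOn_differentiableOn_deriv (fun k hk => ?_) fun k hk => ?_
  · have hk : k ≤ d - 2 := by exact_mod_cast hk
    exact (continuousOn_const.mul ((hS.convexOn_altDeriv h (by omega)).continuousOn
      isOpen_Ioi)).congr (heq k (by omega))
  · have hk : k < d - 2 := by exact_mod_cast hk
    refine DifferentiableOn.congr (fun x hx => ?_) (heq k (by omega))
    exact ((hS.differentiableAt_altDeriv h (by omega) hx).const_mul _).differentiableWithinAt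

lemma Surv.eventuallyEq_iteratedDeriv (h : IsGenerator ψ) (hS : Surv ψ d ψ) (hd : 2 ≤ d) {z : ℝ}
    (hz : 0 < z) : iteratedDeriv (d - 2) ψ =ᶠ[𝓝 z]
      fun x => (-1) ^ (d - 2) * altDeriv ψ (d - 2) x := by
  filter_upwards [Ioi_mem_nhds hz] with x hx using hS.iteratedDeriv_eq h (by omega) x hx

lemma Surv.hasDerivWithinAt_iteratedDeriv (h : IsGenerator ψ) (hS : Surv ψ d ψ) (hd : 2 ≤ d)
    {z : ℝ} (hz : 0 < z) : HasDerivWithinAt (iteratedDeriv (d - 2) ψ)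
      ((-1) ^ (d - 1) * altDeriv ψ (d - 1) z) (Iic z) z := by
  have h1 := ((hS.convexOn_altDeriv h (by omega : d - 2 + 2 ≤ d)).hasDerivWithinAt_negLeftDeriv
    hz).const_mul ((-1) ^ (d - 2))
  have h2 := hS.eventuallyEq_iteratedDeriv h hd hz
  refine (h1.congr_of_eventuallyEq (h2.filter_mono nhdsWithin_le_nhds) h2.self_of_nhds).congr_deriv
    ?_
  obtain ⟨e, rfl⟩ := Nat.exists_eq_add_of_le' hd
  rw [show e + 2 - 1 = (e + 2 - 2) + 1 by omega, pow_succ, altDeriv]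
  ring

lemma Surv.genDeriv_eq (h : IsGenerator ψ) (hS : Surv ψ d ψ) (hd : 2 ≤ d) {k : ℕ}
    (hk : k + 1 ≤ d) {w : ℝ≥0∞} (hw : w ≠ 0) :
    genDeriv d k ψ w = (-1) ^ k * extendTop (altDeriv ψ k) w := by
  by_cases hwt : w = ∞
  · simp [genDeriv, extendTop, hwt]
  have hz : 0 < w.toReal := ENNReal.toReal_pos hw hwt
  rw [genDeriv, extendTop, extendTop, if_neg hwt, if_neg hwt]
  split_ifs with hkd
  · rw [leftDeriv, (hS.hasDerivWithinAt_iteratedDeriv h hd hz).derivWithin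
      (uniqueDiffWithinAt_Iic _), show d - 1 = k by omega]
  · exact hS.iteratedDeriv_eq h (by omega) _ hz

end Regularity

/-! ### Iterated integrals over orthants -/

section Orthant

lemma setLIntegral_pi_Ioi_succ {n : ℕ} (v : Fin (n + 1) → ℝ) {Φ : (Fin (n + 1) → ℝ) → ℝ≥0∞}
    (hΦ : Measurable Φ) :
    ∫⁻ s in univ.pi fun i => Ioi (v i), Φ s =
      ∫⁻ x in Ioi (v 0), ∫⁻ s in univ.pi fun i : Fin n => Ioi (v i.succ),
        Φ (Fin.cons x s : Fin (n + 1) → ℝ) := by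
  have hmp := (volume_preserving_piFinSuccAbove (fun _ : Fin (n + 1) => ℝ) 0).symm
  have hpre : (MeasurableEquiv.piFinSuccAbove (fun _ : Fin (n + 1) => ℝ) 0).symm ⁻¹'
      (univ.pi fun i => Ioi (v i)) =
        Ioi (v 0) ×ˢ univ.pi fun i : Fin n => Ioi (v i.succ) := by
    ext p
    simp [MeasurableEquiv.piFinSuccAbove, Fin.forall_fin_succ]
  rw [← hmp.setLIntegral_comp_preimage_emb (MeasurableEquiv.measurableEmbedding _), hpre,
    Measure.volume_eq_prod, ← Measure.prod_restrict, lintegral_prod]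
  · simp only [MeasurableEquiv.piFinSuccAbove, Fin.insertNthEquiv_zero]
    rfl
  · exact (hΦ.comp (MeasurableEquiv.measurable _)).aemeasurable

lemma setLIntegral_Ioi_add (g : ℝ → ℝ≥0∞) (a t : ℝ) :
    ∫⁻ r in Ioi a, g (r + t) = ∫⁻ r in Ioi (a + t), g r := by
  have h := (measurePreserving_add_right volume t).setLIntegral_comp_preimage_emb
    (measurableEmbedding_addRight t) g (Ioi (a + t))
  rwa [show (fun r => r + t) ⁻¹' Ioi (a + t) = Ioi a by ext r; simp] at h

/-- If `G (j + 1)` is minus the derivative of `G j` in integrated form, then the integral of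
`G n` over an `n`-dimensional orthant is a value of `G 0`. -/
lemma setLIntegral_pi_Ioi_of_primitive (n : ℕ) : ∀ (G : ℕ → ℝ → ℝ),
    (∀ j, Measurable (G (j + 1))) →
    (∀ j, j < n → ∀ a, 0 < a →
      ∫⁻ r in Ioi a, ENNReal.ofReal (G (j + 1) r) = ENNReal.ofReal (G j a)) →
    ∀ (v : Fin n → ℝ), (∀ i, 0 ≤ v i) → ∀ w, 0 < w →
      ∫⁻ s in univ.pi fun i => Ioi (v i), ENNReal.ofReal (G n (w + ∑ i, s i)) =
        ENNReal.ofReal (G 0 (w + ∑ i, v i)) := by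
  induction n with
  | zero =>
    intro G _ _ v _ w _
    have : (univ.pi fun i => Ioi (v i)) = univ := by
      ext s; simp
    rw [this, Measure.restrict_univ, volume_pi, Measure.pi_of_empty, lintegral_dirac]
    simp
  | succ n ih =>
    intro G hG hprim v hv w hw
    have hm : Measurable fun s : Fin (n + 1) → ℝ => ENNReal.ofReal (G (n + 1) (w + ∑ i, s i)) :=
      ((hG n).comp (by fun_prop)).ennreal_ofReal
    rw [setLIntegral_pi_Ioi_succ v hm]
    have hinner : ∀ x ∈ Ioi (v 0), ∫⁻ s in univ.pi fun i : Fin n => Ioi (v i.succ),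
        ENNReal.ofReal (G (n + 1) (w + ∑ i, (Fin.cons x s : Fin (n + 1) → ℝ) i)) =
          ENNReal.ofReal (G 1 (x + (w + ∑ i : Fin n, v i.succ))) := by
      intro x hx
      have hx0 : 0 < w + x := add_pos_of_pos_of_nonneg hw ((hv 0).trans (le_of_lt hx))
      have := ih (fun j => G (j + 1)) (fun j => hG (j + 1))
        (fun j hj a ha => hprim (j + 1) (by omega) a ha) (fun i => v i.succ) (fun i => hv _)
        (w + x) hx0
      simp only [Fin.sum_cons, ← add_assoc]
      rw [this]
      ring_nf
    rw [setLIntegral_congr_fun measurableSet_Ioi hinner,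
      setLIntegral_Ioi_add (fun r => ENNReal.ofReal (G 1 r)), hprim 0 (by omega), Fin.sum_univ_succ]
    · ring_nf
    · linarith [hv 0, Finset.sum_nonneg fun (i : Fin n) (_ : i ∈ Finset.univ) => hv i.succ]

/-- The orthant may touch the origin, where only `G 0` is controlled. The first coordinate is
integrated last: for fixed `x > v 0 ≥ 0` the inner integrals stay away from 0, and the final one
involves only `G 0`. -/
lemma setLIntegral_pi_Ioi_succ_of_primitive {n : ℕ} {G : ℕ → ℝ → ℝ}
    (hG : ∀ j, Measurable (G (j + 1)))
    (hprim : ∀ j, j < n + 1 → ∀ a, 0 ≤ a → (j = 0 ∨ 0 < a) →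
      ∫⁻ r in Ioi a, ENNReal.ofReal (G (j + 1) r) = ENNReal.ofReal (G j a))
    {v : Fin (n + 1) → ℝ} (hv : ∀ i, 0 ≤ v i) :
    ∫⁻ s in univ.pi fun i => Ioi (v i), ENNReal.ofReal (G (n + 1) (∑ i, s i)) =
      ENNReal.ofReal (G 0 (∑ i, v i)) := by
  have hm : Measurable fun s : Fin (n + 1) → ℝ => ENNReal.ofReal (G (n + 1) (∑ i, s i)) :=
    ((hG n).comp (by fun_prop)).ennreal_ofReal
  rw [setLIntegral_pi_Ioi_succ v hm]
  have hinner : ∀ x ∈ Ioi (v 0), ∫⁻ s in univ.pi fun i : Fin n => Ioi (v i.succ),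
      ENNReal.ofReal (G (n + 1) (∑ i, (Fin.cons x s : Fin (n + 1) → ℝ) i)) =
        ENNReal.ofReal (G 1 (x + ∑ i : Fin n, v i.succ)) := by
    intro x hx
    simp only [Fin.sum_cons]
    exact setLIntegral_pi_Ioi_of_primitive n (fun j => G (j + 1)) (fun j => hG (j + 1))
      (fun j hj a ha => hprim (j + 1) (by omega) a ha.le (Or.inr ha)) (fun i => v i.succ)
      (fun i => hv _) x (lt_of_le_of_lt (hv 0) hx)
  rw [setLIntegral_congr_fun measurableSet_Ioi hinner,
    setLIntegral_Ioi_add (fun r => ENNReal.ofReal (G 1 r)), hprim 0 (by omega) _ _ (Or.inl rfl),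
    Fin.sum_univ_succ]
  exact add_nonneg (hv 0) (Finset.sum_nonneg fun i _ => hv _)

end Orthant

/-! ### Derivatives of the generator as densities, cut at its first zero -/

section Density

variable {ψ : ℝ → ℝ} {d : ℕ}

/-- The function `(-1)^k ψ^(k)(· + t)`, cut off at the first zero of `ψ`. -/
noncomputable def cutDeriv (ψ : ℝ → ℝ) (k : ℕ) (t : ℝ) : ℝ → ℝ :=
  {r | 0 < pt ψ r}.indicator fun r => altDeriv ψ k (r + t)

lemma cutDeriv_of_pos {k : ℕ} {t r : ℝ} (hr : 0 < pt ψ r) :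
    cutDeriv ψ k t r = altDeriv ψ k (r + t) :=
  indicator_of_mem (s := {r | 0 < pt ψ r}) hr _

lemma cutDeriv_of_not_pos {k : ℕ} {t r : ℝ} (hr : ¬0 < pt ψ r) : cutDeriv ψ k t r = 0 :=
  indicator_of_notMem (s := {r | 0 < pt ψ r}) hr _

lemma measurable_altDeriv_succ (ψ : ℝ → ℝ) (k : ℕ) : Measurable (altDeriv ψ (k + 1)) :=
  measurable_negLeftDeriv _

lemma IsGenerator.measurable_cutDeriv (h : IsGenerator ψ) (k : ℕ) (t : ℝ) :
    Measurable (cutDeriv ψ (k + 1) t) :=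
  ((measurable_altDeriv_succ ψ k).comp (by fun_prop)).indicator
    (isOpen_lt continuous_const h.continuous_pt).measurableSet

lemma Surv.setLIntegral_altDeriv (h : IsGenerator ψ) (hS : Surv ψ d ψ) {k : ℕ} (hk : k + 2 ≤ d)
    {a : ℝ} (ha : 0 ≤ a) (hka : k = 0 ∨ 0 < a) :
    ∫⁻ r in Ioi a, ENNReal.ofReal (altDeriv ψ (k + 1) r) = ENNReal.ofReal (altDeriv ψ k a) := by
  have hconv := hS.convexOn_altDeriv h hk
  refine hconv.lintegral_Ioi_negLeftDeriv (hS.antitoneOn_altDeriv h (by omega))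
    (hS.tendsto_altDeriv h (by omega) (by omega)) ha ?_
  by_cases ha0 : 0 < a
  · exact ((hconv.continuousOn isOpen_Ioi).continuousAt (Ioi_mem_nhds ha0)).continuousWithinAt
  · obtain rfl : k = 0 := hka.resolve_right ha0
    exact (h.continuousOn a ha).mono (Ioi_subset_Ici ha)

lemma Surv.setLIntegral_cutDeriv (h : IsGenerator ψ) (hS : Surv ψ d ψ) {k : ℕ} (hk : k + 2 ≤ d)
    {a t : ℝ} (ha : 0 ≤ a) (hka : k = 0 ∨ 0 < a) (ht : 0 ≤ t) :
    ∫⁻ r in Ioi a, ENNReal.ofReal (cutDeriv ψ (k + 1) t r) =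
      ENNReal.ofReal (altDeriv ψ k (a + t)) := by
  rw [← hS.setLIntegral_altDeriv h hk (add_nonneg ha ht) (hka.imp_right fun h => by linarith),
    ← setLIntegral_Ioi_add (fun r => ENNReal.ofReal (altDeriv ψ (k + 1) r))]
  refine setLIntegral_congr_fun_ae measurableSet_Ioi ?_
  -- The cut changes the integrand only where `ψ r = 0` but the derivative at `r + t` is nonzero.
  -- Since derivatives vanish strictly beyond any zero, there is at most one such `r`.
  have hsub : {r | 0 < r ∧ ψ r = 0 ∧ altDeriv ψ (k + 1) (r + t) ≠ 0}.Subsingleton := by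
    have key : ∀ r r', 0 < r → ψ r = 0 → r < r' → altDeriv ψ (k + 1) (r' + t) = 0 :=
      fun r r' hr hr0 hrr => h.altDeriv_eq_zero (k + 1) hr hr0 _ (by linarith)
    rintro r ⟨hr, hr0, hr1⟩ r' ⟨hr', hr0', hr1'⟩
    rcases lt_trichotomy r r' with hlt | heq | hlt
    · exact absurd (key r r' hr hr0 hlt) hr1'
    · exact heq
    · exact absurd (key r' r hr' hr0' hlt) hr1
  filter_upwards [compl_mem_ae_iff.2 (hsub.measure_zero volume)] with r hr hra
  have hr0 : 0 < r := lt_of_le_of_lt ha hra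
  by_cases hpos : 0 < pt ψ r
  · rw [cutDeriv_of_pos hpos]
  · rw [cutDeriv_of_not_pos hpos]
    have h1 : ψ r = 0 := by
      refine le_antisymm ?_ (h.nonneg hr0.le)
      rw [← h.coe_pt hr0.le]
      exact not_lt.1 hpos
    by_cases h2 : altDeriv ψ (k + 1) (r + t) = 0
    · rw [h2]
    · exact absurd ⟨hr0, h1, h2⟩ hr

lemma Surv.setLIntegral_pi_cutDeriv (h : IsGenerator ψ) (hS : Surv ψ d ψ) {k : ℕ}
    (hk : k + 2 ≤ d) {t : ℝ} (ht : 0 ≤ t) {v : Fin (k + 1) → ℝ} (hv : ∀ i, 0 ≤ v i) :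
    ∫⁻ s in univ.pi fun i => Ioi (v i), ENNReal.ofReal (cutDeriv ψ (k + 1) t (∑ i, s i)) =
      ENNReal.ofReal (ψ (∑ i, v i + t)) := by
  -- Only the top function is cut. The innermost integration removes the cut and returns the
  -- ordinary derivative of order `k`.
  let G : ℕ → ℝ → ℝ := fun j => if j = k + 1 then cutDeriv ψ (k + 1) t else
    fun r => altDeriv ψ j (r + t)
  have hGm : ∀ j, Measurable (G (j + 1)) := fun j => by
    by_cases hj : j + 1 = k + 1
    · simp only [G, if_pos hj]
      exact h.measurable_cutDeriv k t
    · simp only [G, if_neg hj]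
      exact (measurable_altDeriv_succ ψ j).comp (by fun_prop)
  have := setLIntegral_pi_Ioi_succ_of_primitive (n := k) hGm (fun j hj a ha hja => ?_) hv
  · simpa [G, altDeriv] using this
  · have hjk : j ≠ k + 1 := by omega
    by_cases hj' : j + 1 = k + 1
    · obtain rfl : j = k := by omega
      simp only [G, if_true, if_neg hjk]
      exact hS.setLIntegral_cutDeriv h hk ha hja ht
    · simp only [G, if_neg hj', if_neg hjk]
      rw [setLIntegral_Ioi_add (fun r => ENNReal.ofReal (altDeriv ψ (j + 1) r))]
      exact hS.setLIntegral_altDeriv h (by omega) (by linarith) (hja.imp_right fun h => by linarith)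

end Density

/-! ### Lower boxes generate the Borel sets -/

/-- The boxes `[0, ψ(s)]` with all coordinates of `ψ(s)` positive. -/
def ptBoxes (ψ : ℝ → ℝ) (m : ℕ) : Set (Set (Fin m → I)) :=
  {B | ∃ s : Fin m → ℝ, (∀ i, 0 ≤ s i) ∧ (∀ i, 0 < ψ (s i)) ∧ (Iic fun i => pt ψ (s i)) = B}

section Boxes

variable {ψ : ℝ → ℝ} {m : ℕ}

lemma isPiSystem_ptBoxes (h : IsGenerator ψ) (m : ℕ) : IsPiSystem (ptBoxes ψ m) := by
  rintro _ ⟨s, hs, hps, rfl⟩ _ ⟨t, ht, hpt, rfl⟩ -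
  refine ⟨fun i => max (s i) (t i), fun i => le_max_of_le_left (hs i), fun i => ?_, ?_⟩
  · change 0 < ψ (max (s i) (t i))
    rcases max_choice (s i) (t i) with hi | hi <;> rw [hi]
    exacts [hps i, hpt i]
  · rw [Iic_inter_Iic]
    congr 1
    ext i
    simp only [Pi.inf_apply, h.antitone_pt.map_max]

lemma univ_mem_ptBoxes (h : IsGenerator ψ) (m : ℕ) : univ ∈ ptBoxes ψ m := by
  refine ⟨fun _ => 0, fun _ => le_rfl, fun _ => by rw [h.map_zero]; exact one_pos, ?_⟩
  simp only [h.pt_zero]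
  exact eq_univ_of_forall fun u => mem_Iic.2 fun i => (le_top : u i ≤ ⊤)

lemma borel_eq_generateFrom_ptBoxes (h : IsGenerator ψ) (m : ℕ) :
    (inferInstance : MeasurableSpace (Fin m → I)) =
      MeasurableSpace.generateFrom (ptBoxes ψ m) := by
  refine le_antisymm ?_ (MeasurableSpace.generateFrom_le ?_)
  · refine iSup_le fun i => ?_
    rw [← measurable_iff_comap_le]
    have hpos : ∀ v : I, 0 < (v : ℝ) → MeasurableSet[MeasurableSpace.generateFrom (ptBoxes ψ m)]
        ((fun u : Fin m → I => u i) ⁻¹' Iic v) := by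
      intro v hv
      obtain ⟨s, hs, rfl⟩ := h.exists_pt_eq_of_pos hv
      rw [h.coe_pt hs] at hv
      refine MeasurableSpace.measurableSet_generateFrom ⟨Pi.single i s, fun j => ?_, fun j => ?_, ?_⟩
      · rcases eq_or_ne j i with rfl | hj
        · simpa using hs
        · simp [hj]
      · rcases eq_or_ne j i with rfl | hj
        · simpa using hv
        · simp [hj, h.map_zero]
      · ext u
        simp only [mem_Iic, mem_preimage, Pi.le_def]
        refine ⟨fun hu => by simpa using hu i, fun hu j => ?_⟩
        rcases eq_or_ne j i with rfl | hj
        · simpa using hu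
        · rw [Pi.single_eq_of_ne hj, h.pt_zero]
          exact le_top
    refine @measurable_of_Iic _ _ _ _ _ (MeasurableSpace.generateFrom (ptBoxes ψ m)) _ _ _ _ fun v => ?_
    -- The level 0 may not be a value of `ψ`, and is excluded from `ptBoxes` anyway; it is reached
    -- as a countable intersection of positive levels.
    rcases v.2.1.eq_or_lt with hv | hv
    · have hvn : ∀ n : ℕ, 1 / ((n : ℝ) + 1) ∈ I := fun n =>
        ⟨by positivity, by
          rw [div_le_one (by positivity)]
          linarith [(Nat.cast_nonneg n : (0 : ℝ) ≤ n)]⟩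
      have heq : (fun u : Fin m → I => u i) ⁻¹' Iic v =
          ⋂ n : ℕ, (fun u : Fin m → I => u i) ⁻¹' Iic ⟨_, hvn n⟩ := by
        ext u
        simp only [mem_preimage, mem_Iic, mem_iInter, ← Subtype.coe_le_coe, ← hv]
        refine ⟨fun hu n => hu.trans (by positivity), fun hu => ?_⟩
        exact ge_of_tendsto' tendsto_one_div_add_atTop_nhds_zero_nat hu
      rw [heq]
      exact MeasurableSet.iInter fun n => hpos _ (by positivity)
    · exact hpos v hv
  · rintro _ ⟨s, -, -, rfl⟩
    exact measurableSet_Iic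

lemma ext_of_ptBoxes (h : IsGenerator ψ) {μ ν : Measure (Fin m → I)} [IsFiniteMeasure μ]
    (hμν : ∀ s : Fin m → ℝ, (∀ i, 0 ≤ s i) → (∀ i, 0 < ψ (s i)) →
      μ (Iic fun i => pt ψ (s i)) = ν (Iic fun i => pt ψ (s i))) : μ = ν := by
  have key : ∀ B ∈ ptBoxes ψ m, μ B = ν B := by
    rintro _ ⟨s, hs, hps, rfl⟩
    exact hμν s hs hps
  exact ext_of_generate_finite _ (borel_eq_generateFrom_ptBoxes h m) (isPiSystem_ptBoxes h m) key
    (key _ (univ_mem_ptBoxes h m))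

lemma ext_prod_of_ptBoxes (h : IsGenerator ψ) {k : ℕ} {μ ν : Measure ((Fin k → I) × (Fin m → I))}
    [IsFiniteMeasure μ]
    (hμν : ∀ (s : Fin k → ℝ) (t : Fin m → ℝ), (∀ i, 0 ≤ s i) → (∀ i, 0 < ψ (s i)) →
      (∀ i, 0 ≤ t i) → (∀ i, 0 < ψ (t i)) →
        μ ((Iic fun i => pt ψ (s i)) ×ˢ Iic fun i => pt ψ (t i)) =
          ν ((Iic fun i => pt ψ (s i)) ×ˢ Iic fun i => pt ψ (t i))) : μ = ν := by
  have key : ∀ B ∈ image2 (· ×ˢ ·) (ptBoxes ψ k) (ptBoxes ψ m), μ B = ν B := by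
    rintro _ ⟨_, ⟨s, hs, hps, rfl⟩, _, ⟨t, ht, hpt, rfl⟩, rfl⟩
    exact hμν s t hs hps ht hpt
  have hspan : ∀ n, IsCountablySpanning (ptBoxes ψ n) := fun n =>
    ⟨fun _ => univ, fun _ => univ_mem_ptBoxes h n, iUnion_const _⟩
  refine ext_of_generate_finite _ (generateFrom_eq_prod (borel_eq_generateFrom_ptBoxes h k).symm
    (borel_eq_generateFrom_ptBoxes h m).symm (hspan k) (hspan m)).symm
    ((isPiSystem_ptBoxes h k).prod (isPiSystem_ptBoxes h m)) key ?_
  rw [← univ_prod_univ]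
  exact key _ ⟨_, univ_mem_ptBoxes h k, _, univ_mem_ptBoxes h m, rfl⟩

end Boxes

/-! ### The first coordinates of an Archimedean copula -/

section Law

variable {ψ : ℝ → ℝ} {ℓ m : ℕ} {C : (Fin (ℓ + m) → I) → ℝ} {μ : Measure (Fin (ℓ + m) → I)}

lemma IsArchimedeanCopula.apply_pt {d : ℕ} {C : (Fin d → I) → ℝ} (hC : IsArchimedeanCopula ψ C)
    {s : Fin d → ℝ} (hs : ∀ i, 0 ≤ s i) : C (fun i => pt ψ (s i)) = ψ (∑ i, s i) := by
  rw [hC.eq, hC.isGenerator.extendTop_sum_pseudoInv_pt hs]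

lemma measurable_castAdd : Measurable fun (u : Fin (ℓ + m) → I) (i : Fin ℓ) => u (Fin.castAdd m i) :=
  measurable_pi_lambda _ fun _ => measurable_pi_apply _

lemma measurable_natAdd : Measurable fun (u : Fin (ℓ + m) → I) (j : Fin m) => u (Fin.natAdd ℓ j) :=
  measurable_pi_lambda _ fun _ => measurable_pi_apply _

lemma IsArchimedeanCopula.map_prod_apply (hC : IsArchimedeanCopula ψ C)
    (hμ : IsStochasticMeasure C μ) {s : Fin ℓ → ℝ} {t : Fin m → ℝ} (hs : ∀ i, 0 ≤ s i)
    (ht : ∀ i, 0 ≤ t i) :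
    μ.map (fun u => (fun i : Fin ℓ => u (Fin.castAdd m i), fun j : Fin m => u (Fin.natAdd ℓ j)))
      ((Iic fun i => pt ψ (s i)) ×ˢ Iic fun i => pt ψ (t i)) =
        ENNReal.ofReal (ψ (∑ i, s i + ∑ j, t j)) := by
  have := hμ.isProbabilityMeasure
  have hst : ∀ i, 0 ≤ Fin.append s t i := fun i => by
    refine Fin.addCases (fun i => ?_) (fun j => ?_) i
    · simpa using hs i
    · simpa using ht j
  have h1 := hμ.cdf fun i => pt ψ (Fin.append s t i)
  rw [hC.apply_pt hst, Fin.sum_univ_add] at h1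
  simp only [Fin.append_left, Fin.append_right] at h1
  rw [← h1, ofReal_measureReal, Measure.map_apply (measurable_castAdd.prodMk measurable_natAdd)
    (measurableSet_Iic.prod measurableSet_Iic)]
  congr 1
  ext u
  simp only [mem_preimage, mem_prod, mem_Iic, Pi.le_def]
  constructor
  · rintro ⟨h2, h3⟩ i
    refine Fin.addCases (fun i => ?_) (fun j => ?_) i
    · simpa using h2 i
    · simpa using h3 j
  · intro h2
    exact ⟨fun i => by simpa using h2 (Fin.castAdd m i), fun j => by simpa using h2 (Fin.natAdd ℓ j)⟩

lemma IsArchimedeanCopula.map_castAdd_apply (hC : IsArchimedeanCopula ψ C)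
    (hμ : IsStochasticMeasure C μ) {s : Fin ℓ → ℝ} (hs : ∀ i, 0 ≤ s i) :
    μ.map (fun u (i : Fin ℓ) => u (Fin.castAdd m i)) (Iic fun i => pt ψ (s i)) =
        ENNReal.ofReal (ψ (∑ i, s i)) := by
  have h1 := hC.map_prod_apply hμ hs (t := fun _ => 0) fun _ => le_rfl
  rw [Measure.map_apply (measurable_castAdd.prodMk measurable_natAdd)
    (measurableSet_Iic.prod measurableSet_Iic)] at h1
  rw [Measure.map_apply measurable_castAdd measurableSet_Iic]
  simp only [hC.isGenerator.pt_zero, Finset.sum_const_zero, add_zero] at h1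
  rw [← h1]
  congr 1
  ext u
  simp only [mem_preimage, mem_prod, mem_Iic]
  exact (and_iff_left fun j => (le_top : u (Fin.natAdd ℓ j) ≤ ⊤)).symm

/-- The distribution on the cube which has, in the coordinates given by `ψ`, the density
`(-1)^n ψ^(n)(s₁ + ⋯ + s_n)`. -/
noncomputable def densityLaw (ψ : ℝ → ℝ) (n : ℕ) : Measure (Fin n → I) :=
  ((volume.restrict (univ.pi fun _ : Fin n => Ioi (0 : ℝ))).withDensity
    fun s => ENNReal.ofReal (cutDeriv ψ n 0 (∑ i, s i))).map fun s i => pt ψ (s i)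

lemma IsGenerator.measurable_pt_comp (h : IsGenerator ψ) {n : ℕ} :
    Measurable fun (s : Fin n → ℝ) i => pt ψ (s i) :=
  measurable_pi_lambda _ fun i => h.continuous_pt.measurable.comp (measurable_pi_apply i)

lemma IsGenerator.setLIntegral_densityLaw (h : IsGenerator ψ) {n : ℕ}
    {Φ : (Fin (n + 1) → I) → ℝ≥0∞} (hΦ : Measurable Φ) {s : Fin (n + 1) → ℝ} (hs : ∀ i, 0 ≤ s i)
    (hps : ∀ i, 0 < ψ (s i)) :
    ∫⁻ x in Iic fun i => pt ψ (s i), Φ x ∂(densityLaw ψ (n + 1)) =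
      ∫⁻ v in univ.pi fun i => Ioi (s i),
        ENNReal.ofReal (cutDeriv ψ (n + 1) 0 (∑ i, v i)) * Φ fun i => pt ψ (v i) := by
  have hm : Measurable fun v : Fin (n + 1) → ℝ =>
      ENNReal.ofReal (cutDeriv ψ (n + 1) 0 (∑ i, v i)) :=
    ((h.measurable_cutDeriv n 0).comp (by fun_prop)).ennreal_ofReal
  have hpre : MeasurableSet ((fun (v : Fin (n + 1) → ℝ) i => pt ψ (v i)) ⁻¹'
      Iic fun i => pt ψ (s i)) := h.measurable_pt_comp measurableSet_Iic
  have hΦ' : Measurable fun v : Fin (n + 1) → ℝ => Φ fun i => pt ψ (v i) :=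
    hΦ.comp h.measurable_pt_comp
  rw [densityLaw, setLIntegral_map measurableSet_Iic hΦ h.measurable_pt_comp,
    setLIntegral_withDensity_eq_setLIntegral_mul _ hm hΦ' hpre,
    Measure.restrict_restrict hpre]
  have hset : ((fun (v : Fin (n + 1) → ℝ) i => pt ψ (v i)) ⁻¹' Iic fun i => pt ψ (s i)) ∩
      (univ.pi fun _ => Ioi 0) = Ici s ∩ univ.pi fun _ => Ioi 0 := by
    ext v
    simp only [mem_inter_iff, mem_preimage, mem_Iic, mem_Ici, Pi.le_def, Set.mem_pi, mem_univ,
      true_imp_iff, mem_Ioi]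
    refine and_congr_left fun hv => forall_congr' fun i => ?_
    exact h.pt_le_iff (hv i).le (hs i) (hps i)
  rw [hset]
  refine setLIntegral_congr ?_
  have h1 := (Measure.univ_pi_Ioi_ae_eq_Ici (μ := fun _ : Fin (n + 1) => (volume : Measure ℝ))
    (f := s)).symm.inter (ae_eq_refl (univ.pi fun _ : Fin (n + 1) => Ioi (0 : ℝ)))
  refine h1.trans (Eventually.of_forall fun v => ?_)
  have : (univ.pi fun i => Ioi (s i)) ∩ (univ.pi fun _ : Fin (n + 1) => Ioi (0 : ℝ)) =
      univ.pi fun i => Ioi (s i) :=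
    inter_eq_left.2 fun v hv i hi => lt_of_le_of_lt (hs i) (hv i hi)
  rw [this]

/-- Both laws give the box with corner `ψ(s)` the mass `ψ(∑ s_i)`, by the marginal of the copula on
one side and the orthant integral on the other. -/
lemma IsArchimedeanCopula.map_castAdd_eq (hC : IsArchimedeanCopula ψ C) (hμ : IsStochasticMeasure C μ)
    (hℓ : 1 ≤ ℓ) (hm : 1 ≤ m) :
    μ.map (fun u (i : Fin ℓ) => u (Fin.castAdd m i)) = densityLaw ψ ℓ := by
  have := hμ.isProbabilityMeasure
  obtain ⟨n, rfl⟩ := Nat.exists_eq_add_of_le' hℓ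
  refine ext_of_ptBoxes hC.isGenerator fun s hs hps => ?_
  have h1 := hC.isGenerator.setLIntegral_densityLaw (n := n) (Φ := fun _ => 1) measurable_const
    hs hps
  rw [setLIntegral_one] at h1
  simp only [mul_one] at h1
  rw [h1, hC.surv.setLIntegral_pi_cutDeriv hC.isGenerator (by omega) le_rfl hs, add_zero,
    hC.map_castAdd_apply hμ hs]

end Law

/-! ### The Markov kernel -/

/-- The points `x` at which the kernel is not degenerate: `x ≠ (1, …, 1)` and
`C(x, 1, …, 1) ≠ 0`. -/
def regularSet (ψ : ℝ → ℝ) (ℓ : ℕ) : Set (Fin ℓ → I) :=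
  {x | (¬∀ i, x i = 1) ∧ extendTop ψ (∑ i, pseudoInv ψ (x i)) ≠ 0}

section Kernel

variable {ψ : ℝ → ℝ} {ℓ m k : ℕ} {C : (Fin (ℓ + m) → I) → ℝ}

lemma IsGenerator.measurable_sum_pseudoInv (h : IsGenerator ψ) :
    Measurable fun x : Fin ℓ → I => ∑ i, pseudoInv ψ (x i) :=
  Finset.measurable_sum _ fun i _ => h.measurable_pseudoInv.comp (measurable_pi_apply i)

lemma IsGenerator.measurableSet_regularSet (h : IsGenerator ψ) (ℓ : ℕ) :
    MeasurableSet (regularSet ψ ℓ) := by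
  have h1 : MeasurableSet {x : Fin ℓ → I | ∀ i, x i = 1} := by
    have : {x : Fin ℓ → I | ∀ i, x i = 1} = {fun _ => 1} := by
      ext x; simp [funext_iff]
    rw [this]
    exact measurableSet_singleton _
  have h2 : Measurable fun x : Fin ℓ → I => extendTop ψ (∑ i, pseudoInv ψ (x i)) :=
    h.antitone_extendTop.measurable.comp h.measurable_sum_pseudoInv
  exact h1.compl.inter (h2 (measurableSet_singleton 0).compl)

lemma IsGenerator.exists_of_mem_regularSet (h : IsGenerator ψ) {x : Fin ℓ → I}
    (hx : x ∈ regularSet ψ ℓ) :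
    ∃ z, 0 < z ∧ 0 < ψ z ∧ ∑ i, pseudoInv ψ (x i) = ENNReal.ofReal z := by
  obtain ⟨hx1, hx2⟩ := hx
  have htop : ∑ i, pseudoInv ψ (x i) ≠ ∞ := fun ht => hx2 (by rw [ht, extendTop_top])
  have hz : ∑ i, pseudoInv ψ (x i) ≠ 0 := fun h0 => hx1 fun i =>
    h.pseudoInv_eq_zero_iff.1 (Finset.sum_eq_zero_iff.1 h0 i (Finset.mem_univ i))
  refine ⟨(∑ i, pseudoInv ψ (x i)).toReal, ENNReal.toReal_pos hz htop, ?_,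
    (ENNReal.ofReal_toReal htop).symm⟩
  rw [extendTop, if_neg htop] at hx2
  exact (h.nonneg ENNReal.toReal_nonneg).lt_of_ne' hx2

lemma IsGenerator.pt_mem_regularSet (h : IsGenerator ψ) {v : Fin (k + 1) → ℝ} (hv : ∀ i, 0 < v i)
    (hpos : 0 < ψ (∑ i, v i)) : (fun i => pt ψ (v i)) ∈ regularSet ψ (k + 1) ∧
      ∑ i, pseudoInv ψ (pt ψ (v i)) = ENNReal.ofReal (∑ i, v i) := by
  refine ⟨⟨fun hall => ?_, ?_⟩, ?_⟩
  · have h1 : ψ (v 0) = 1 := by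
      rw [← h.coe_pt (hv 0).le, show pt ψ (v 0) = 1 from hall 0]; rfl
    have h2 := h.lt_of_lt le_rfl (hv 0) (by rw [h.map_zero]; exact one_pos)
    rw [h1, h.map_zero] at h2
    exact lt_irrefl _ h2
  · rw [h.extendTop_sum_pseudoInv_pt fun i => (hv i).le]
    exact hpos.ne'
  · rw [← sum_ofReal fun i => (hv i).le]
    refine Finset.sum_congr rfl fun i _ => h.pseudoInv_pt (hv i).le (hpos.trans_le ?_)
    exact h.antitoneOn (hv i).le (Finset.sum_nonneg fun j _ => (hv j).le)
      (Finset.single_le_sum (fun j _ => (hv j).le) (Finset.mem_univ i))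

lemma Surv.exists_isProbabilityMeasure (h : IsGenerator ψ) (hS : Surv ψ (k + 1 + (m + 1)) ψ)
    {z : ℝ} (hz : 0 < z) (hpos : 0 < ψ z) :
    ∃ ν : Measure (Fin (m + 1) → I), IsProbabilityMeasure ν ∧
      ∀ t : Fin (m + 1) → ℝ, (∀ i, 0 ≤ t i) → ν.real (Iic fun i => pt ψ (t i)) =
        altDeriv ψ (k + 1) (z + ∑ i, t i) / altDeriv ψ (k + 1) z := by
  have hp := hS.altDeriv_pos h (k := k + 1) (by omega) hz hpos
  obtain ⟨ν, hν, hs⟩ := (hS.surv_altDeriv h hz).const_mul (inv_nonneg.2 hp.le)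
  have hs' : ∀ t : Fin (m + 1) → ℝ, (∀ i, 0 ≤ t i) → ν.real (Iic fun i => pt ψ (t i)) =
      altDeriv ψ (k + 1) (z + ∑ i, t i) / altDeriv ψ (k + 1) z := fun t ht => by
    rw [hs t ht, div_eq_inv_mul]
  refine ⟨ν, ⟨?_⟩, hs'⟩
  have h1 := hs' (fun _ => 0) fun _ => le_rfl
  simp only [h.pt_zero, Finset.sum_const_zero, add_zero, div_self hp.ne'] at h1
  rw [show (Iic fun _ : Fin (m + 1) => (1 : I)) = univ from
    eq_univ_of_forall fun u => mem_Iic.2 fun i => (le_top : u i ≤ ⊤)] at h1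
  rwa [Measure.real, ENNReal.toReal_eq_one_iff] at h1

/-- The kernel exists, with the correct values on boxes `[0, ψ(t)]`. -/
lemma Surv.exists_kernel (h : IsGenerator ψ) (hS : Surv ψ (k + 1 + (m + 1)) ψ) :
    ∃ K : Kernel (Fin (k + 1) → I) (Fin (m + 1) → I), IsMarkovKernel K ∧
      (∀ x ∉ regularSet ψ (k + 1), K x = Measure.dirac 0) ∧
      ∀ x ∈ regularSet ψ (k + 1), ∀ z, ∑ i, pseudoInv ψ (x i) = ENNReal.ofReal z → 0 < z →
        ∀ t : Fin (m + 1) → ℝ, (∀ i, 0 ≤ t i) → (K x).real (Iic fun i => pt ψ (t i)) =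
          altDeriv ψ (k + 1) (z + ∑ i, t i) / altDeriv ψ (k + 1) z := by
  have hex : ∀ x : Fin (k + 1) → I, ∃ ν : Measure (Fin (m + 1) → I), IsProbabilityMeasure ν ∧
      (x ∉ regularSet ψ (k + 1) → ν = Measure.dirac 0) ∧
      (x ∈ regularSet ψ (k + 1) → ∀ t : Fin (m + 1) → ℝ, (∀ i, 0 ≤ t i) →
        ν.real (Iic fun i => pt ψ (t i)) =
          altDeriv ψ (k + 1) ((∑ i, pseudoInv ψ (x i)).toReal + ∑ i, t i) /
            altDeriv ψ (k + 1) (∑ i, pseudoInv ψ (x i)).toReal) := by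
    intro x
    by_cases hx : x ∈ regularSet ψ (k + 1)
    · obtain ⟨z, hz, hpos, hzx⟩ := h.exists_of_mem_regularSet hx
      obtain ⟨ν, hν, hs⟩ := hS.exists_isProbabilityMeasure h hz hpos
      refine ⟨ν, hν, fun hx' => absurd hx hx', fun _ t ht => ?_⟩
      rw [hs t ht, hzx, ENNReal.toReal_ofReal hz.le]
    -- The point mass at 0 lies in every box `[0, y]`, which matches the prescribed value 1.
    · exact ⟨Measure.dirac 0, inferInstance, fun _ => rfl, fun hx' => absurd hx' hx⟩
  choose κ hκp hκd hκ using hex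
  have hmeas : Measurable κ := by
    refine Measurable.measure_of_isPiSystem_of_isProbabilityMeasure
      (borel_eq_generateFrom_ptBoxes h (m + 1)) (isPiSystem_ptBoxes h (m + 1)) ?_
    rintro _ ⟨t, ht, -, rfl⟩
    classical
    have heq : (fun x => κ x (Iic fun i => pt ψ (t i))) = fun x => ENNReal.ofReal
        (if x ∈ regularSet ψ (k + 1) then
          altDeriv ψ (k + 1) ((∑ i, pseudoInv ψ (x i)).toReal + ∑ i, t i) /
            altDeriv ψ (k + 1) (∑ i, pseudoInv ψ (x i)).toReal else 1) := by
      ext x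
      rw [← ofReal_measureReal]
      congr 1
      split_ifs with hx
      · exact hκ x hx t ht
      · rw [hκd x hx, measureReal_def, Measure.dirac_apply' _ measurableSet_Iic,
          indicator_of_mem (mem_Iic.2 fun i => (bot_le : ⊥ ≤ pt ψ (t i)))]
        simp
    rw [heq]
    have hz : Measurable fun x : Fin (k + 1) → I => (∑ i, pseudoInv ψ (x i)).toReal :=
      h.measurable_sum_pseudoInv.ennreal_toReal
    have hf := measurable_altDeriv_succ ψ k
    exact (Measurable.ite (h.measurableSet_regularSet _)
      ((hf.comp (hz.add_const _)).div (hf.comp hz)) measurable_const).ennreal_ofReal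
  refine ⟨⟨κ, hmeas⟩, ⟨hκp⟩, hκd, fun x hx z hzx hz t ht => ?_⟩
  have := hκ x hx t ht
  rwa [hzx, ENNReal.toReal_ofReal hz.le] at this

/-- The values of the kernel on all boxes. -/
lemma Surv.real_Iic_eq (h : IsGenerator ψ) (hS : Surv ψ (k + 1 + (m + 1)) ψ) {z : ℝ} (hz : 0 < z)
    {ν : Measure (Fin (m + 1) → I)} [IsFiniteMeasure ν]
    (hν : ∀ t : Fin (m + 1) → ℝ, (∀ i, 0 ≤ t i) → ν.real (Iic fun i => pt ψ (t i)) =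
      altDeriv ψ (k + 1) (z + ∑ i, t i) / altDeriv ψ (k + 1) z) (y : Fin (m + 1) → I) :
    ν.real (Iic y) = extendTop (altDeriv ψ (k + 1)) (ENNReal.ofReal z + ∑ j, pseudoInv ψ (y j)) /
      altDeriv ψ (k + 1) z := by
  by_cases hy : ∀ j, pseudoInv ψ (y j) ≠ ∞
  · choose t ht hty htφ using fun j => h.exists_of_pseudoInv_ne_top (hy j)
    have h1 := hν t ht
    simp only [hty] at h1
    rw [h1, Finset.sum_congr rfl fun j _ => htφ j, sum_ofReal ht,
      ← ENNReal.ofReal_add hz.le (Finset.sum_nonneg fun i _ => ht i),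
      extendTop_ofReal _ (add_nonneg hz.le (Finset.sum_nonneg fun i _ => ht i))]
  · push Not at hy
    obtain ⟨j, hj⟩ := hy
    have hsum : ∑ j, pseudoInv ψ (y j) = ∞ := ENNReal.sum_eq_top.2 ⟨j, Finset.mem_univ j, hj⟩
    rw [hsum, add_top, extendTop_top, zero_div]
    have hyj : y j ≤ 0 := by
      by_contra! hlt
      exact h.pseudoInv_ne_top_of_pos hlt hj
    -- Here `y j = 0` and `φ(0) = ∞`, so the box lies in every box constrained by `ψ(r)` in
    -- coordinate `j`; their masses tend to 0 as `r → ∞`.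
    refine le_antisymm ?_ measureReal_nonneg
    have hlim : Tendsto (fun r => altDeriv ψ (k + 1) (z + r) / altDeriv ψ (k + 1) z) atTop (𝓝 0) := by
      rw [← zero_div (altDeriv ψ (k + 1) z)]
      exact ((hS.tendsto_altDeriv h (by omega) (by omega)).comp
        (tendsto_atTop_add_const_left _ z tendsto_id)).div_const _
    refine ge_of_tendsto hlim ?_
    filter_upwards [eventually_ge_atTop 0] with r hr
    have h1 := hν (Pi.single j r) fun i => by
      rcases eq_or_ne i j with rfl | hi
      · simpa using hr
      · simp [hi]
    rw [Finset.sum_pi_single' j r] at h1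
    simp only [Finset.mem_univ, if_true] at h1
    rw [← h1]
    refine measureReal_mono (Iic_subset_Iic.2 fun i => ?_)
    rcases eq_or_ne i j with rfl | hi
    · exact hyj.trans bot_le
    · simp only [Pi.single_eq_of_ne hi, h.pt_zero]
      exact le_top

/-- `(-1)^k ψ^(k)` vanishes at points of the interior of the zero set. -/
lemma IsArchimedeanCopula.extendTop_altDeriv_eq_zero {d : ℕ} {C : (Fin d → I) → ℝ}
    (hC : IsArchimedeanCopula ψ C) (k : ℕ) {u : Fin d → I} (hu : u ∈ interior (zeroSet C)) :
    extendTop (altDeriv ψ k) (∑ i, pseudoInv ψ (u i)) = 0 := by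
  have h := hC.isGenerator
  by_cases htop : ∀ i, pseudoInv ψ (u i) ≠ ∞
  · choose s hs hsu hsφ using fun i => h.exists_of_pseudoInv_ne_top (htop i)
    have hsum : 0 ≤ ∑ i, s i := Finset.sum_nonneg fun i _ => hs i
    rw [Finset.sum_congr rfl fun j _ => hsφ j, sum_ofReal hs, extendTop_ofReal _ hsum]
    have hcont : Continuous fun (a : ℝ) i => pt ψ (a * s i) :=
      continuous_pi fun i => h.continuous_pt.comp (continuous_mul_const _)
    -- Scaling by `a < 1` close to 1 stays in the open interior. Thus `a * ∑ s i` is already a zero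
    -- of `ψ`, and `∑ s i` lies strictly beyond it.
    have hev : ∀ᶠ a in 𝓝 (1 : ℝ), (fun i => pt ψ (a * s i)) ∈ interior (zeroSet C) := by
      refine hcont.continuousAt.eventually_mem (isOpen_interior.mem_nhds ?_)
      simpa [hsu] using hu
    obtain ⟨a, ha, ha1⟩ := ((hev.filter_mono (nhdsWithin_le_nhds (s := Iio 1))).and
      (Ioo_mem_nhdsLT zero_lt_one)).exists
    have hmem : (fun i => pt ψ (a * s i)) ∈ zeroSet C := interior_subset ha
    have h0 : C (fun i => pt ψ (a * s i)) = 0 := hmem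
    rw [hC.apply_pt fun i => mul_nonneg ha1.1.le (hs i), ← Finset.mul_sum] at h0
    have hpos : 0 < ∑ i, s i := by
      refine hsum.lt_of_ne fun h1 => ?_
      rw [← h1, mul_zero, h.map_zero] at h0
      exact one_ne_zero h0
    exact h.altDeriv_eq_zero k (mul_pos ha1.1 hpos) h0 _ (mul_lt_of_lt_one_left hpos ha1.2)
  · push Not at htop
    obtain ⟨i, hi⟩ := htop
    rw [ENNReal.sum_eq_top.2 ⟨i, Finset.mem_univ i, hi⟩, extendTop_top]

lemma IsArchimedeanCopula.mem_regularSet_iff (hC : IsArchimedeanCopula ψ C) (x : Fin ℓ → I) :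
    x ∈ regularSet ψ ℓ ↔ ¬((∀ i, x i = 1) ∨ x ∈ zeroSet (firstMarginal C)) := by
  have h1 : firstMarginal C x = extendTop ψ (∑ i, pseudoInv ψ (x i)) := by
    rw [firstMarginal, hC.eq, Fin.sum_univ_add]
    simp [hC.isGenerator.pseudoInv_eq_zero_iff.2]
  rw [not_or, zeroSet, mem_ofPred_eq, h1]
  rfl

lemma IsArchimedeanCopula.kernelCDF_of_notMem (hC : IsArchimedeanCopula ψ C) {x : Fin ℓ → I}
    (hx : x ∉ regularSet ψ ℓ) (y : Fin m → I) : kernelCDF ψ C x y = 1 := by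
  rw [hC.mem_regularSet_iff, not_not] at hx
  rw [kernelCDF, if_pos hx]

/-- On the interior of the zero set the quotient is itself zero, so the last two cases merge; the
signs `(-1)^ℓ` cancel. -/
lemma IsArchimedeanCopula.kernelCDF_of_mem (hC : IsArchimedeanCopula ψ C) (hℓ : 1 ≤ ℓ)
    (hm : 1 ≤ m) {x : Fin ℓ → I} (hx : x ∈ regularSet ψ ℓ) {z : ℝ} (hz : 0 < z)
    (hzx : ∑ i, pseudoInv ψ (x i) = ENNReal.ofReal z) (y : Fin m → I) :
    kernelCDF ψ C x y = extendTop (altDeriv ψ ℓ)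
      (ENNReal.ofReal z + ∑ j, pseudoInv ψ (y j)) / altDeriv ψ ℓ z := by
  have h := hC.isGenerator
  have hz0 : ENNReal.ofReal z ≠ 0 := (ENNReal.ofReal_pos.2 hz).ne'
  rw [kernelCDF, if_neg ((hC.mem_regularSet_iff x).1 hx), hzx]
  split_ifs with hint
  · have h1 := hC.extendTop_altDeriv_eq_zero ℓ hint
    rw [Fin.sum_univ_add] at h1
    simp only [Fin.append_left, Fin.append_right] at h1
    rw [hzx] at h1
    rw [h1, zero_div]
  · rw [hC.surv.genDeriv_eq h (by omega) (by omega) hz0,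
      hC.surv.genDeriv_eq h (by omega) (by omega) (fun h0 => hz0 (add_eq_zero.1 h0).1),
      extendTop_ofReal _ hz.le, mul_div_mul_left _ _ (pow_ne_zero _ (by norm_num))]

/-- The joint distribution of the two blocks of coordinates disintegrates along the kernel. -/
lemma IsArchimedeanCopula.map_prod_eq_compProd {C : (Fin (k + 1 + (m + 1)) → I) → ℝ}
    {μ : Measure (Fin (k + 1 + (m + 1)) → I)} (hC : IsArchimedeanCopula ψ C)
    (hμ : IsStochasticMeasure C μ) (K : Kernel (Fin (k + 1) → I) (Fin (m + 1) → I))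
    [IsMarkovKernel K]
    (hK : ∀ x ∈ regularSet ψ (k + 1), ∀ z, ∑ i, pseudoInv ψ (x i) = ENNReal.ofReal z → 0 < z →
      ∀ t : Fin (m + 1) → ℝ, (∀ i, 0 ≤ t i) → (K x).real (Iic fun i => pt ψ (t i)) =
        altDeriv ψ (k + 1) (z + ∑ i, t i) / altDeriv ψ (k + 1) z) :
    μ.map (fun u => (fun i : Fin (k + 1) => u (Fin.castAdd (m + 1) i),
      fun j : Fin (m + 1) => u (Fin.natAdd (k + 1) j))) =
        (μ.map fun u (i : Fin (k + 1)) => u (Fin.castAdd (m + 1) i)) ⊗ₘ K := by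
  have h := hC.isGenerator
  have := hμ.isProbabilityMeasure
  refine ext_prod_of_ptBoxes h fun s t hs hps ht hpt => ?_
  rw [hC.map_prod_apply hμ hs ht, Measure.compProd_apply_prod measurableSet_Iic measurableSet_Iic,
    hC.map_castAdd_eq hμ (by omega) (by omega),
    h.setLIntegral_densityLaw (K.measurable_coe measurableSet_Iic) hs hps,
    ← hC.surv.setLIntegral_pi_cutDeriv h (by omega : k + 2 ≤ k + 1 + (m + 1))
      (Finset.sum_nonneg fun i _ => ht i) hs]
  -- With both masses written over the same orthant, the integrands agree pointwise: where `ψ(∑ v i)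
  -- > 0` the density cancels the denominator of the kernel, and elsewhere the cut makes both
  -- vanish, whatever the degenerate kernel is.
  refine setLIntegral_congr_fun (MeasurableSet.univ_pi fun _ => measurableSet_Ioi) fun v hv => ?_
  have hv0 : ∀ i, 0 < v i := fun i => lt_of_le_of_lt (hs i) (hv i (mem_univ i))
  have hsum : 0 < ∑ i, v i := Finset.sum_pos (fun i _ => hv0 i) Finset.univ_nonempty
  by_cases hpos : 0 < pt ψ (∑ i, v i)
  · rw [cutDeriv_of_pos hpos, cutDeriv_of_pos hpos, add_zero]
    have hpos' : 0 < ψ (∑ i, v i) := by rwa [← h.coe_pt hsum.le]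
    obtain ⟨hmem, hφ⟩ := h.pt_mem_regularSet hv0 hpos'
    have hp := hC.surv.altDeriv_pos h (k := k + 1) (by omega) hsum hpos'
    rw [← ofReal_measureReal (s := Iic fun i => pt ψ (t i)), hK _ hmem _ hφ hsum t ht,
      ← ENNReal.ofReal_mul hp.le, mul_div_cancel₀ _ hp.ne']
  · rw [cutDeriv_of_not_pos hpos, cutDeriv_of_not_pos hpos, ENNReal.ofReal_zero, zero_mul]

end Kernel

end ArchCopula

theorem theorem3p1 (ℓ m : ℕ) (hℓ : 1 ≤ ℓ) (hm : 1 ≤ m) (ψ : ℝ → ℝ)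
    (C : (Fin (ℓ + m) → I) → ℝ) (hC : ArchCopula.IsArchimedeanCopula ψ C)
    (μ : Measure (Fin (ℓ + m) → I)) (hμ : ArchCopula.IsStochasticMeasure C μ) :
    (ContDiffOn ℝ ((ℓ + m - 2 : ℕ) : WithTop ℕ∞) ψ (Ioi 0) ∧
      ∀ z : ℝ, 0 < z →
        DifferentiableWithinAt ℝ (iteratedDeriv (ℓ + m - 2) ψ) (Iic z) z) ∧
    ∃ K : Kernel (Fin ℓ → I) (Fin m → I),
      (∀ (x : Fin ℓ → I) (y : Fin m → I),
        (K x).real (Iic y) = ArchCopula.kernelCDF ψ C x y) ∧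
      ArchCopula.IsMarkovKernelOf K μ := by
  have h := hC.isGenerator
  have hS := hC.surv
  have := hμ.isProbabilityMeasure
  refine ⟨⟨hS.contDiffOn h (by omega), fun z hz =>
    (hS.hasDerivWithinAt_iteratedDeriv h (by omega) hz).differentiableWithinAt⟩, ?_⟩
  obtain ⟨k, rfl⟩ := Nat.exists_eq_add_of_le' hℓ
  obtain ⟨n, rfl⟩ := Nat.exists_eq_add_of_le' hm
  obtain ⟨K, hKM, hKd, hK⟩ := hS.exists_kernel h
  refine ⟨K, fun x y => ?_, hKM, fun E hE => ?_⟩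
  · by_cases hx : x ∈ ArchCopula.regularSet ψ (k + 1)
    · obtain ⟨z, hz, -, hzx⟩ := h.exists_of_mem_regularSet hx
      rw [hC.kernelCDF_of_mem hℓ hm hx hz hzx y]
      exact hS.real_Iic_eq h hz (hK x hx z hzx hz) y
    · rw [hC.kernelCDF_of_notMem hx, hKd x hx, measureReal_def,
        Measure.dirac_apply' _ measurableSet_Iic,
        indicator_of_mem (mem_Iic.2 fun i => (bot_le : ⊥ ≤ y i))]
      simp
  · have hX := ArchCopula.measurable_castAdd (ℓ := k + 1) (m := n + 1)
    have hY := ArchCopula.measurable_natAdd (ℓ := k + 1) (m := n + 1)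
    have h1 := condDistrib_ae_eq_of_measure_eq_compProd _ hY.aemeasurable
      (hC.map_prod_eq_compProd hμ K hK)
    have h2 := ae_of_ae_map hX.aemeasurable h1
    have h3 := condDistrib_ae_eq_condExp (μ := μ) hX hY hE
    have h4 : (fun u : Fin (k + 1 + (n + 1)) → I => E.indicator (fun _ => (1 : ℝ))
        fun j : Fin (n + 1) => u (Fin.natAdd (k + 1) j)) =
        ((fun u (j : Fin (n + 1)) => u (Fin.natAdd (k + 1) j)) ⁻¹' E).indicator fun _ => (1 : ℝ) :=
      rfl
    rw [h4]
    filter_upwards [h2, h3] with u hu hu'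
    rw [← hu', hu]
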